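/- Work in the half-space model $\mathbb{H}^{n+1}=\{(x,y)\in\mathbb{R}^n\times\mathbb{R}:y>0\}$ with metric $(|dx|^2+dy^2)/y^2$. Let $K=\{\lambda\in\mathbb{R}^n:\lambda_i>0 \text{ for all } i\}$ and let $f$ be a symmetric function, continuous on $\overline K$ and differentiable in $K$, such that, with $f_i=\partial f/\partial\lambda_i$: (a) $f_i>0$ in $K$ for every $i$; (b) $f$ is concave in $K$; (c) $f>0$ in $K$ and $f=0$ on $\partial K$; (d) $f(1,\dots,1)=1$; (e) $f$ is homogeneous of degree one; (f) there are $\epsilon_0>0$ and $\delta_0>0$ such that $\lim_{R\to+\infty}f(\lambda_1,\dots,\lambda_{n-1},\lambda_n+R)\ge 1+\epsilon_0$ uniformly for $\lambda\in K$ with $|\lambda-(1,\dots,1)|<\delta_0$. Assume in addition that $\sum_i f_i(\lambda)>\sum_i\lambda_i^2f_i(\lambda)$ for all $\lambda\in K$ with $0<f(\lambda)<1$. Let $\Omega\subset\mathbb{R}^n$ be a bounded domain with smooth boundary, and let $\Sigma_i=\{(x,u_i(x)):x\in\Omega\}$, $i=1,2$, with $u_i\in C^2(\Omega)\cap C^0(\overline\Omega)$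 and $u_i>0$ in $\Omega$, be strictly locally convex graphs: all their hyperbolic principal curvatures $\kappa[\Sigma_i]=(\kappa_1,\dots,\kappa_n)$ with respect to the upward unit normal are positive. Suppose that the two graphs have the same boundary in one of the following senses: (i) asymptotic boundary $\partial\Omega$: $u_1=u_2=0$ on $\partial\Omega$; or (ii) boundary in a horosphere: $u_1=u_2=\epsilon$ on $\partial\Omega$ for some constant $\epsilon>0$, and in this case suppose also that $f(\kappa[\Sigma_1])<1$ at every point of $\Sigma_1$. If $f(\kappa[\Sigma_1])$ is bounded above and $\sup_{\Omega}f(\kappa[\Sigma_1])<f(\kappa[\Sigma_2])$ at every point of $\Sigma_2$, then $u_1>u_2$ in $\Omega$. -/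

import Mathlib

open scoped ContDiff InnerProductSpace Topology Gradient

namespace HyperbolicGraph

noncomputable section

/-! Geometry of vertical graphs in the half-space model of hyperbolic `(n+1)`-space: the ambient
points and vectors are pairs `(x, y)`, with `x` in Euclidean `n`-space and `y` the height. -/

/-- The Euclidean inner product of two ambient vectors. -/
def euclInner {n : ℕ} (V W : EuclideanSpace ℝ (Fin n) × ℝ) : ℝ :=
  ⟪V.1, W.1⟫_ℝ + V.2 * W.2

/-- The hyperbolic metric `(dx² + dy²) / y²` at the point `p`. -/
def hypMetric {n : ℕ} (p V W : EuclideanSpace ℝ (Fin n) × ℝ) : ℝ :=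
  euclInner V W / p.2 ^ 2

/-- The Christoffel term `Γ_p(V, W)` of the Levi-Civita connection of the hyperbolic metric, so that
`D_V W = ∂_V W + Γ_p(V, W)` in the half-space coordinates. -/
def hypChristoffel {n : ℕ} (p V W : EuclideanSpace ℝ (Fin n) × ℝ) :
    EuclideanSpace ℝ (Fin n) × ℝ :=
  (-(1 / p.2)) • (V.2 • W + W.2 • V - euclInner V W • ((0, 1) : EuclideanSpace ℝ (Fin n) × ℝ))

/-- The connection given by `hypChristoffel` is torsion free. -/
theorem hypChristoffel_comm {n : ℕ} (p V W : EuclideanSpace ℝ (Fin n) × ℝ) :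
    hypChristoffel p V W = hypChristoffel p W V := by
  simp only [hypChristoffel, euclInner, real_inner_comm W.1 V.1, mul_comm V.2 W.2,
    add_comm (V.2 • W)]

/-- The connection given by `hypChristoffel` is compatible with the hyperbolic metric (together
with the symmetry this says that it is the Levi-Civita connection). -/
theorem hypChristoffel_compat {n : ℕ} (p V W Z : EuclideanSpace ℝ (Fin n) × ℝ) (hp : 0 < p.2) :
    HasDerivAt (fun t : ℝ => hypMetric (p + t • Z) V W)
      (hypMetric p (hypChristoffel p Z V) W + hypMetric p V (hypChristoffel p Z W)) 0 := by
  have h1 : HasDerivAt (fun t : ℝ => p.2 + t * Z.2) Z.2 0 := by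
    simpa using ((hasDerivAt_id (0 : ℝ)).mul_const Z.2).const_add p.2
  have h2 := (hasDerivAt_const (0 : ℝ) (euclInner V W)).div (h1.pow 2)
    (by simpa using hp.ne')
  refine HasDerivAt.congr_deriv (f := fun t : ℝ => hypMetric (p + t • Z) V W) h2 ?_
  simp only [hypMetric, hypChristoffel, euclInner, Prod.smul_fst, Prod.smul_snd, Prod.fst_sub,
    Prod.snd_sub, Prod.fst_add, Prod.snd_add, inner_smul_left, inner_smul_right, inner_sub_left,
    inner_sub_right, inner_add_left, inner_add_right, inner_zero_left, inner_zero_right,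
    smul_eq_mul, Pi.pow_apply, RCLike.conj_to_real, real_inner_comm Z.1 V.1, zero_mul,
    add_zero]
  have := hp.ne'
  field_simp
  ring

/-- The point of the graph of `u` above `x`. -/
def graphPoint {n : ℕ} (u : EuclideanSpace ℝ (Fin n) → ℝ) (x : EuclideanSpace ℝ (Fin n)) :
    EuclideanSpace ℝ (Fin n) × ℝ :=
  (x, u x)

/-- The tangent vector of the graph of `u` above `x` in the coordinate direction `v`. -/
def graphTangent {n : ℕ} (u : EuclideanSpace ℝ (Fin n) → ℝ) (x v : EuclideanSpace ℝ (Fin n)) :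
    EuclideanSpace ℝ (Fin n) × ℝ :=
  (v, fderiv ℝ u x v)

/-- `w = √(1 + |Du|²)`. -/
def slopeFactor {n : ℕ} (u : EuclideanSpace ℝ (Fin n) → ℝ) (x : EuclideanSpace ℝ (Fin n)) : ℝ :=
  Real.sqrt (1 + ‖∇ u x‖ ^ 2)

/-- The upward unit normal of the graph of `u` with respect to the hyperbolic metric,
`u (-Du, 1) / w`. -/
def graphNormal {n : ℕ} (u : EuclideanSpace ℝ (Fin n) → ℝ) (x : EuclideanSpace ℝ (Fin n)) :
    EuclideanSpace ℝ (Fin n) × ℝ :=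
  (u x / slopeFactor u x) • (-∇ u x, 1)

/-- The hyperbolic first fundamental form of the graph of `u`. -/
def firstForm {n : ℕ} (u : EuclideanSpace ℝ (Fin n) → ℝ) (x v w : EuclideanSpace ℝ (Fin n)) : ℝ :=
  hypMetric (graphPoint u x) (graphTangent u x v) (graphTangent u x w)

/-- The hyperbolic second fundamental form `⟨D_{X_v} X_w, ν⟩` of the graph of `u`, with respect to
the upward unit normal; `(0, D²u(v, w))` is the flat derivative of the tangent field `X_w`. -/
def secondForm {n : ℕ} (u : EuclideanSpace ℝ (Fin n) → ℝ) (x v w : EuclideanSpace ℝ (Fin n)) : ℝ :=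
  hypMetric (graphPoint u x)
    ((0, fderiv ℝ (fderiv ℝ u) x v w) +
      hypChristoffel (graphPoint u x) (graphTangent u x v) (graphTangent u x w))
    (graphNormal u x)

/-- `κ` lists, in some order and with multiplicity, the hyperbolic principal curvatures of the graph
of `u` above `x`: some basis of tangent directions, orthonormal for the first fundamental form,
diagonalizes the second fundamental form with diagonal entries `κ`. -/
def IsPrincipalCurvatures {n : ℕ} (u : EuclideanSpace ℝ (Fin n) → ℝ) (x : EuclideanSpace ℝ (Fin n))
    (κ : Fin n → ℝ) : Prop :=
  ∃ v : Fin n → EuclideanSpace ℝ (Fin n), ∀ i j,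
    firstForm u x (v i) (v j) = (if i = j then 1 else 0) ∧
    secondForm u x (v i) (v j) = (if i = j then κ i else 0)

/-- The hyperbolic principal curvatures of the graph of `u` above `x`, with respect to the upward
normal, in an arbitrary order. -/
def principalCurvatures {n : ℕ} (u : EuclideanSpace ℝ (Fin n) → ℝ)
    (x : EuclideanSpace ℝ (Fin n)) : Fin n → ℝ :=
  Classical.epsilon (IsPrincipalCurvatures u x)

theorem firstForm_eq {n : ℕ} (u : EuclideanSpace ℝ (Fin n) → ℝ)
    (x v w : EuclideanSpace ℝ (Fin n)) :
    firstForm u x v w = (⟪v, w⟫_ℝ + fderiv ℝ u x v * fderiv ℝ u x w) / u x ^ 2 := rfl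

theorem secondForm_eq {n : ℕ} (u : EuclideanSpace ℝ (Fin n) → ℝ)
    (x v w : EuclideanSpace ℝ (Fin n)) (hu : 0 < u x) :
    secondForm u x v w = (fderiv ℝ (fderiv ℝ u) x v w / u x + firstForm u x v w)
      / slopeFactor u x := by
  have hw : 0 < slopeFactor u x := Real.sqrt_pos.2 (by positivity)
  have hg : ∀ z, ⟪z, ∇ u x⟫_ℝ = fderiv ℝ u x z := fun z => by
    rw [real_inner_comm, gradient, InnerProductSpace.toDual_symm_apply]
  simp only [secondForm, firstForm, hypMetric, hypChristoffel, euclInner, graphNormal, graphPoint,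
    graphTangent, Prod.smul_fst, Prod.smul_snd, Prod.fst_sub, Prod.snd_sub, Prod.fst_add,
    Prod.snd_add, inner_smul_right, inner_neg_right, smul_eq_mul, hg, map_add, map_sub, map_smul,
    map_zero]
  field_simp
  ring

/-- Above a point where `u` is positive and of class `C²`, principal curvatures exist. -/
theorem isPrincipalCurvatures_principalCurvatures {n : ℕ} (u : EuclideanSpace ℝ (Fin n) → ℝ)
    (x : EuclideanSpace ℝ (Fin n)) (hu : 0 < u x) (hC : ContDiffAt ℝ 2 u x) :
    IsPrincipalCurvatures u x (principalCurvatures u x) := by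
  apply Classical.epsilon_spec
  have hw : 0 < slopeFactor u x := Real.sqrt_pos.2 (by positivity)
  have hw2 : slopeFactor u x ^ 2 = 1 + ‖∇ u x‖ ^ 2 := Real.sq_sqrt (by positivity)
  have hg : ∀ z, fderiv ℝ u x z = ⟪∇ u x, z⟫_ℝ := fun z => by
    rw [gradient, InnerProductSpace.toDual_symm_apply]
  have hsymm : IsSymmSndFDerivAt ℝ u x := hC.isSymmSndFDerivAt (by simp)
  set p := ∇ u x with hp
  set w := slopeFactor u x with hwdef
  set D := fderiv ℝ (fderiv ℝ u) x with hD
  let c : ℝ := 1 / (w * (1 + w))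
  let P : EuclideanSpace ℝ (Fin n) →ₗ[ℝ] EuclideanSpace ℝ (Fin n) :=
    u x • (LinearMap.id - c • (LinearMap.toSpanSingleton ℝ _ p ∘ₗ (innerₛₗ ℝ p)))
  have hP : ∀ z, P z = u x • (z - (c * ⟪p, z⟫_ℝ) • p) := fun z => by
    simp [P, smul_smul]
  have hPs : ∀ y z, ⟪P y, z⟫_ℝ = ⟪y, P z⟫_ℝ := fun y z => by
    simp only [hP, inner_smul_left, inner_smul_right, inner_sub_left, inner_sub_right,
      RCLike.conj_to_real, real_inner_comm p y]
    ring
  have hPg : ∀ y z, firstForm u x (P y) (P z) = ⟪y, z⟫_ℝ := fun y z => by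
    rw [firstForm_eq, hg, hg]
    simp only [hP, inner_smul_left, inner_smul_right, inner_sub_left, inner_sub_right,
      RCLike.conj_to_real, real_inner_comm p y, real_inner_self_eq_norm_sq]
    have e : ‖p‖ ^ 2 = w ^ 2 - 1 := by linarith
    have hw1 : 1 + w ≠ 0 := by positivity
    rw [e]
    simp only [c]
    field_simp
    ring
  let S : EuclideanSpace ℝ (Fin n) →ₗ[ℝ] EuclideanSpace ℝ (Fin n) :=
    ((InnerProductSpace.toDual ℝ (EuclideanSpace ℝ (Fin n))).symm.toLinearEquiv.toLinearMap) ∘ₗ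
      D.toLinearMap
  have hS : ∀ y z, ⟪S y, z⟫_ℝ = D y z := fun y z => by
    simp only [S, LinearMap.comp_apply]
    exact InnerProductSpace.toDual_symm_apply
  let L := P ∘ₗ S ∘ₗ P
  have hL' : ∀ y z, ⟪L y, z⟫_ℝ = D (P y) (P z) := fun y z => by
    simp only [L, LinearMap.comp_apply]
    rw [hPs, hS]
  have hL : L.IsSymmetric := fun y z => by
    rw [hL', real_inner_comm, hL']
    exact hsymm _ _
  have hn : Module.finrank ℝ (EuclideanSpace ℝ (Fin n)) = n := by simp
  let b := hL.eigenvectorBasis hn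
  refine ⟨fun i => (hL.eigenvalues hn i / u x + 1) / w, fun i => P (b i), fun i j => ⟨?_, ?_⟩⟩
  · rw [hPg, orthonormal_iff_ite.1 b.orthonormal i j]
  · rw [secondForm_eq u x _ _ hu, hPg, ← hD, ← hL', orthonormal_iff_ite.1 b.orthonormal i j,
      hL.apply_eigenvectorBasis hn i, inner_smul_left,
      orthonormal_iff_ite.1 b.orthonormal i j]
    split_ifs <;> simp [← hwdef]

/-- The graph of `u` over `Ω` is a strictly locally convex `C²` hypersurface of the half-space (all
its principal curvatures with respect to the upward normal are positive), and `u` is continuous up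
to the boundary of `Ω`. -/
structure IsStrictlyLocallyConvexGraph {n : ℕ} (Ω : Set (EuclideanSpace ℝ (Fin n)))
    (u : EuclideanSpace ℝ (Fin n) → ℝ) : Prop where
  contDiffOn : ContDiffOn ℝ 2 u Ω
  continuousOn : ContinuousOn u (closure Ω)
  pos : ∀ x ∈ Ω, 0 < u x
  convex : ∀ x ∈ Ω, ∀ i, 0 < principalCurvatures u x i

/-- `Ω` is a bounded smooth domain: near each boundary point it is a sublevel set `{φ < 0}` of a
smooth function `φ` with nonvanishing differential. -/
structure IsBoundedSmoothDomain {n : ℕ} (Ω : Set (EuclideanSpace ℝ (Fin n))) : Prop where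
  isOpen : IsOpen Ω
  isConnected : IsConnected Ω
  isBounded : Bornology.IsBounded Ω
  smooth_boundary : ∀ p ∈ frontier Ω, ∃ φ : EuclideanSpace ℝ (Fin n) → ℝ,
    ContDiff ℝ ∞ φ ∧ φ p = 0 ∧ fderiv ℝ φ p ≠ 0 ∧ ∀ᶠ x in 𝓝 p, (x ∈ Ω ↔ φ x < 0)

/-- The open positive cone `K`. -/
def posCone (n : ℕ) : Set (Fin n → ℝ) := {l | ∀ i, 0 < l i}

/-- The partial derivative `f_i = ∂f/∂λ_i`. -/
def partialDeriv {n : ℕ} (f : (Fin n → ℝ) → ℝ) (i : Fin n) (l : Fin n → ℝ) : ℝ :=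
  fderiv ℝ f l (Pi.single i 1)

/-- The structure conditions on the curvature function `f`. -/
structure IsCurvatureFunction {n : ℕ} (f : (Fin n → ℝ) → ℝ) : Prop where
  symmetric : ∀ (s : Equiv.Perm (Fin n)), ∀ l ∈ posCone n, f (l ∘ s) = f l
  continuousOn : ContinuousOn f (closure (posCone n))
  differentiableOn : DifferentiableOn ℝ f (posCone n)
  partialDeriv_pos : ∀ l ∈ posCone n, ∀ i, 0 < partialDeriv f i l
  concaveOn : ConcaveOn ℝ (posCone n) f
  pos : ∀ l ∈ posCone n, 0 < f l
  zero_boundary : ∀ l ∈ frontier (posCone n), f l = 0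
  normalized : f (fun _ => 1) = 1
  homogeneous : ∀ l ∈ posCone n, ∀ t : ℝ, 0 < t → f (t • l) = t * f l
  /-- `lim_{R → ∞} f(λ₁, …, λ_i + R, …, λ_n) ≥ 1 + ε₀`, uniformly for `λ` in the Euclidean ball of
  radius `δ₀` about `(1, …, 1)`; by symmetry the choice of the coordinate `i` is immaterial. -/
  limit : ∃ ε₀ > 0, ∃ δ₀ > 0, ∀ i : Fin n, ∀ η > 0, ∃ R₀ : ℝ, ∀ R ≥ R₀,
    ∀ l ∈ posCone n, ∑ j, (l j - 1) ^ 2 < δ₀ ^ 2 →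
      1 + ε₀ - η ≤ f (Function.update l i (l i + R))

end

end HyperbolicGraph

open HyperbolicGraph

namespace HyperbolicGraph

/-! ### Curvature functions on the positive cone -/

/-! Suppose `u₁ ≤ u₂` somewhere. Among the points of Σ₁ choose one farthest from the region above
Σ₂, at hyperbolic distance d, and let `z₀` lie under the nearest point of Σ₂ (d = 0 if the graphs
only touch). Heuristically, Σ₁ touches from above the parallel surface of Σ₂ at distance d, whose
principal curvatures are (S + Cκ)/(C + Sκ) with S = sinh d, C = cosh d and κ those of Σ₂. The
inequality ∑ f_i > ∑ λ_i² f_i says that f increases along the parallel flow while f < 1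
(`min_le_parallel`). Hence f(κ₁) ≥ min(f(κ₂), 1), although f(κ₁) is smaller than both.

The parallel surface is never constructed. Instead the pair (x, z) varies freely, and `depthExcess`
measures how deep the point of Σ₁ over x lies below the totally geodesic hyperplane tangent to Σ₂
over z. Convexity of Σ₂ keeps the upper region beyond these hyperplanes (`tangent_hyperplane_le`),
so depth is at most distance (`le_dist_of_depth`), and the extremal pair is a local maximum. Since
`u₂` is only C², the z-derivative of `depthExcess` involves a merely continuous Hessian; but it is
the pairing of `convexVec` with `footDefect`, which vanishes at the maximum, so a second derivative
still exists there. The second-order condition bounds κ₁ below by a doubly stochastic average of the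
parallel curvatures (`exists_doublyStochastic_of_isLocalMax`). By Birkhoff's theorem, a symmetric
concave f does not decrease under such averaging.

A farthest point exists because `u₂ / u₁` has upper limit at most 1 at the boundary. For a boundary
in a horosphere this is continuity. For an asymptotic boundary, spherical caps of curvature s = sup
f(κ₁) serve as barriers below Σ₁ and above Σ₂, and both have the same slope at the boundary
(`eventually_lt_mul_of_zero_boundary`); there f(κ₁) < 1 also follows, from the maximum point of
`u₂`. -/

theorem isOpen_posCone (n : ℕ) : IsOpen (posCone n) := by
  simp only [posCone, Set.ofPred_forall]
  exact isOpen_iInter_of_finite fun i => isOpen_lt continuous_const (continuous_apply i)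

theorem fderiv_eq_sum_partialDeriv {n : ℕ} (f : (Fin n → ℝ) → ℝ) (l v : Fin n → ℝ) :
    fderiv ℝ f l v = ∑ i, v i * partialDeriv f i l := by
  conv_lhs => rw [pi_eq_sum_univ' v]
  simp only [map_sum, map_smul, smul_eq_mul, partialDeriv]

namespace IsCurvatureFunction

variable {n : ℕ} {f : (Fin n → ℝ) → ℝ}

theorem hasFDerivAt (hf : IsCurvatureFunction f) {l : Fin n → ℝ} (hl : l ∈ posCone n) :
    HasFDerivAt f (fderiv ℝ f l) l :=
  ((hf.differentiableOn l hl).differentiableAt ((isOpen_posCone n).mem_nhds hl)).hasFDerivAt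

theorem mono (hf : IsCurvatureFunction f) {l m : Fin n → ℝ} (hl : l ∈ posCone n)
    (hlm : ∀ i, l i ≤ m i) : f l ≤ f m := by
  have hmem : ∀ t : ℝ, 0 ≤ t → l + t • (m - l) ∈ posCone n := fun t ht i => by
    have := mul_nonneg ht (sub_nonneg.2 (hlm i))
    have := hl i
    simp only [Pi.add_apply, Pi.smul_apply, Pi.sub_apply, smul_eq_mul]
    linarith
  have hd : ∀ t : ℝ, 0 ≤ t → HasDerivAt (fun t : ℝ => f (l + t • (m - l)))
      (fderiv ℝ f (l + t • (m - l)) (m - l)) t := fun t ht => by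
    have h1 : HasDerivAt (fun t : ℝ => l + t • (m - l)) (m - l) t := by
      simpa using ((hasDerivAt_id t).smul_const (m - l)).const_add l
    exact (hf.hasFDerivAt (hmem t ht)).comp_hasDerivAt t h1
  have hmono : MonotoneOn (fun t : ℝ => f (l + t • (m - l))) (Set.Icc 0 1) := by
    refine monotoneOn_of_deriv_nonneg (convex_Icc 0 1)
      (fun t ht => (hd t ht.1).continuousAt.continuousWithinAt) (fun t ht => ?_) fun t ht => ?_
    · rw [interior_Icc] at ht
      exact (hd t ht.1.le).differentiableAt.differentiableWithinAt
    · rw [interior_Icc] at ht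
      rw [(hd t ht.1.le).deriv, fderiv_eq_sum_partialDeriv]
      exact Finset.sum_nonneg fun i _ => mul_nonneg (sub_nonneg.2 (hlm i))
        (hf.partialDeriv_pos _ (hmem t ht.1.le) i).le
  simpa using hmono (by simp : (0 : ℝ) ∈ Set.Icc (0 : ℝ) 1) (by simp : (1 : ℝ) ∈ Set.Icc (0 : ℝ) 1)
    zero_le_one

theorem apply_const (hf : IsCurvatureFunction f) {c : ℝ} (hc : 0 < c) : f (fun _ => c) = c := by
  have h := hf.homogeneous (fun _ => 1) (fun _ => one_pos) c hc
  rw [hf.normalized, mul_one] at h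
  rwa [show (c • fun _ => 1 : Fin n → ℝ) = fun _ => c by ext; simp] at h

/-- Averaging by a doubly stochastic matrix does not decrease a curvature function. -/
theorem le_mulVec_of_doublyStochastic (hf : IsCurvatureFunction f) {l : Fin n → ℝ}
    (hl : l ∈ posCone n) {W : Matrix (Fin n) (Fin n) ℝ} (hW : W ∈ doublyStochastic ℝ (Fin n)) :
    f l ≤ f (W.mulVec l) := by
  -- Birkhoff: `W` is a convex combination of permutation matrices. Permuting `l` leaves f
  -- unchanged, so Jensen's inequality finishes.
  obtain ⟨w, hw0, hw1, rfl⟩ := exists_eq_sum_perm_of_mem_doublyStochastic hW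
  have hperm : ∀ σ : Equiv.Perm (Fin n), (σ.permMatrix ℝ).mulVec l = l ∘ σ := fun σ => by
    ext i
    simp [Matrix.permMatrix_mulVec]
  have hmem : ∀ σ : Equiv.Perm (Fin n), l ∘ σ ∈ posCone n := fun σ i => hl (σ i)
  have h := hf.concaveOn.le_map_sum (t := Finset.univ) (w := w) (p := fun σ => l ∘ σ)
    (fun σ _ => hw0 σ) hw1 (fun σ _ => hmem σ)
  have h2 : ∑ σ, w σ • f (l ∘ σ) = f l := by
    simp only [hf.symmetric _ l hl, ← Finset.sum_smul, hw1, one_smul]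
  rw [h2] at h
  refine h.trans_eq ?_
  congr 1
  rw [Matrix.sum_mulVec]
  simp only [Matrix.smul_mulVec, hperm]

/-- Moving a strictly convex hypersurface by its downward normal flow (the parameter is the
hyperbolic tangent of the time) does not decrease the curvature as long as it is below one. -/
theorem min_le_parallel (hf : IsCurvatureFunction f)
    (hf' : ∀ l ∈ posCone n, 0 < f l → f l < 1 →
      ∑ i, l i ^ 2 * partialDeriv f i l < ∑ i, partialDeriv f i l)
    {l : Fin n → ℝ} (hl : l ∈ posCone n) {T : ℝ} (hT : 0 ≤ T) (hT1 : T < 1) :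
    min (f l) 1 ≤ f (fun i => (T + l i) / (1 + T * l i)) := by
  -- This is the addition law of tanh, so each entry satisfies the Riccati equation k' = (1 - k²)/(1
  -- - t²).
  set k : ℝ → Fin n → ℝ := fun t i => (t + l i) / (1 + t * l i) with hk
  have hden : ∀ t : ℝ, 0 ≤ t → ∀ i, 0 < 1 + t * l i := fun t ht i => by
    have := mul_nonneg ht (hl i).le
    linarith
  have hmem : ∀ t : ℝ, 0 ≤ t → k t ∈ posCone n := fun t ht i =>
    div_pos (add_pos_of_nonneg_of_pos ht (hl i)) (hden t ht i)
  have hd : ∀ t : ℝ, 0 ≤ t → t < 1 → HasDerivAt (fun t => f (k t))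
      (fderiv ℝ f (k t) (fun i => (1 - k t i ^ 2) / (1 - t ^ 2))) t := fun t ht ht1 => by
    refine (hf.hasFDerivAt (hmem t ht)).comp_hasDerivAt t (hasDerivAt_pi.2 fun i => ?_)
    have h1 : HasDerivAt (fun t : ℝ => t + l i) 1 t := (hasDerivAt_id t).add_const _
    have h2 : HasDerivAt (fun t : ℝ => 1 + t * l i) (l i) t := by
      simpa using ((hasDerivAt_id t).mul_const (l i)).const_add 1
    refine (h1.div h2 (hden t ht i).ne').congr_deriv ?_
    have h3 := (hden t ht i).ne'
    have h4 : (1 : ℝ) - t ^ 2 ≠ 0 := by nlinarith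
    simp only [hk]
    field_simp
    ring
  -- Working with a level μ strictly below the minimum makes `hf'` applicable whenever f(k t) = μ:
  -- there f ∘ k is strictly increasing, so it cannot cross the level downwards.
  refine le_of_forall_lt fun c hc => ?_
  obtain ⟨μ, hcμ, hμ⟩ := exists_between hc
  refine hcμ.trans_le ?_
  rw [lt_min_iff] at hμ
  have hk0 : k 0 = l := by
    ext i
    simp [hk]
  have := image_le_of_deriv_right_lt_deriv_boundary (f := fun t => -f (k t))
    (f' := fun t => -fderiv ℝ f (k t) (fun i => (1 - k t i ^ 2) / (1 - t ^ 2))) (a := 0) (b := T)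
    (B := fun _ => -μ) (B' := fun _ => 0)
    (fun t ht => (hd t ht.1 (ht.2.trans_lt hT1)).neg.continuousAt.continuousWithinAt)
    (fun t ht => (hd t ht.1 (ht.2.trans hT1)).neg.hasDerivWithinAt)
    (by simpa [hk0] using hμ.1.le) (fun t => hasDerivAt_const _ _)
    (fun t ht h => by
      have h1 : f (k t) = μ := neg_injective h
      have h2 := hf' (k t) (hmem t ht.1) (hf.pos _ (hmem t ht.1)) (h1 ▸ hμ.2)
      have h3 : 0 < 1 - t ^ 2 := by nlinarith [ht.1, ht.2]
      rw [fderiv_eq_sum_partialDeriv, neg_lt_zero]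
      have h4 : ∑ i, (1 - k t i ^ 2) / (1 - t ^ 2) * partialDeriv f i (k t)
          = (∑ i, partialDeriv f i (k t) - ∑ i, k t i ^ 2 * partialDeriv f i (k t))
            / (1 - t ^ 2) := by
        rw [← Finset.sum_sub_distrib, Finset.sum_div]
        exact Finset.sum_congr rfl fun i _ => by ring
      rw [h4]
      exact div_pos (sub_pos.2 h2) h3)
    (Set.right_mem_Icc.2 hT)
  exact neg_le_neg_iff.1 this

end IsCurvatureFunction

end HyperbolicGraph

namespace HyperbolicGraph

/-! ### Second derivative tests for graphs -/

/-- If L > 0, then g' > 0 just to the right of 0 and g increases there, against maximality. Only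
differentiability of g' at the single point 0 is needed; `depthExcess` offers no more. -/
theorem second_deriv_nonpos_of_isLocalMax {g g' : ℝ → ℝ} {L : ℝ} (hmax : IsLocalMax g 0)
    (hg : ∀ᶠ t in 𝓝 0, HasDerivAt g (g' t) t) (hg' : HasDerivAt g' L 0) :
    g' 0 = 0 ∧ L ≤ 0 := by
  have h0 : g' 0 = 0 := hmax.hasDerivAt_eq_zero hg.self_of_nhds
  refine ⟨h0, ?_⟩
  by_contra! hL
  have h1 := (hasDerivAt_iff_tendsto_slope.1 hg').eventually (lt_mem_nhds hL)
  rw [eventually_nhdsWithin_iff] at h1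
  obtain ⟨δ, hδ, h⟩ := Metric.eventually_nhds_iff.1 (h1.and (hg.and hmax))
  have hmem : ∀ t ∈ Set.Icc (0 : ℝ) (δ / 2), dist t 0 < δ := fun t ht => by
    rw [Real.dist_eq, sub_zero, abs_of_nonneg ht.1]
    linarith [ht.2]
  have hmono : StrictMonoOn g (Set.Icc 0 (δ / 2)) := by
    refine strictMonoOn_of_deriv_pos (convex_Icc _ _)
      (fun t ht => (h (hmem t ht)).2.1.continuousAt.continuousWithinAt) fun t ht => ?_
    have ht' := interior_subset ht
    rw [interior_Icc] at ht
    rw [(h (hmem t ht')).2.1.deriv]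
    have := (h (hmem t ht')).1 ht.1.ne'
    rw [slope_def_field, h0, sub_zero, sub_zero] at this
    exact (div_pos_iff_of_pos_right ht.1).1 this
  have h2 := hmono (Set.left_mem_Icc.2 (by positivity)) (Set.right_mem_Icc.2 (by positivity))
    (by positivity : (0 : ℝ) < δ / 2)
  have h3 := (h (hmem (δ / 2) (Set.right_mem_Icc.2 (by positivity)))).2.2
  exact absurd h2 (not_lt.2 h3)

/-- A product of a continuous function with one that is differentiable and vanishes at the point
is differentiable there. -/
theorem hasDerivAt_inner_of_eq_zero {F : Type*} [NormedAddCommGroup F] [InnerProductSpace ℝ F]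
    {p q : ℝ → F} {q' : F} {t : ℝ} (hp : ContinuousAt p t) (hq : HasDerivAt q q' t)
    (h0 : q t = 0) : HasDerivAt (fun s => ⟪p s, q s⟫_ℝ) ⟪p t, q'⟫_ℝ t := by
  rw [hasDerivAt_iff_tendsto_slope] at hq ⊢
  refine ((hp.mono_left nhdsWithin_le_nhds).inner hq).congr fun s => ?_
  simp only [slope, h0, inner_zero_right, vsub_eq_sub, sub_zero, inner_smul_right, smul_eq_mul]

variable {n : ℕ}

local notation "E" => EuclideanSpace ℝ (Fin n)

variable {u : EuclideanSpace ℝ (Fin n) → ℝ} {x : EuclideanSpace ℝ (Fin n)}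

theorem inner_gradient (u : E → ℝ) (x v : E) : ⟪∇ u x, v⟫_ℝ = fderiv ℝ u x v := by
  rw [gradient, InnerProductSpace.toDual_symm_apply]

theorem slopeFactor_pos (u : E → ℝ) (x : E) : 0 < slopeFactor u x :=
  Real.sqrt_pos.2 (by positivity)

theorem slopeFactor_sq (u : E → ℝ) (x : E) : slopeFactor u x ^ 2 = 1 + ‖∇ u x‖ ^ 2 :=
  Real.sq_sqrt (by positivity)

/-! ### Derivatives along lines. -/

theorem hasDerivAt_line (x a : E) (t : ℝ) : HasDerivAt (fun t : ℝ => x + t • a) a t := by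
  simpa using ((hasDerivAt_id t).smul_const a).const_add x

theorem tendsto_line (x a : E) : Filter.Tendsto (fun t : ℝ => x + t • a) (𝓝 0) (𝓝 x) := by
  have := (hasDerivAt_line x a 0).continuousAt.tendsto
  simpa using this

theorem eventually_contDiffAt (hu : ContDiffAt ℝ 2 u x) : ∀ᶠ y in 𝓝 x, ContDiffAt ℝ 2 u y :=
  hu.eventually (by simp)

theorem hasDerivAt_comp_line (hu : ContDiffAt ℝ 2 u x) (a : E) :
    ∀ᶠ t : ℝ in 𝓝 0, HasDerivAt (fun t : ℝ => u (x + t • a)) (fderiv ℝ u (x + t • a) a) t := by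
  filter_upwards [(tendsto_line x a).eventually (eventually_contDiffAt hu)] with t ht
  exact (ht.differentiableAt (by simp)).hasFDerivAt.comp_hasDerivAt t (hasDerivAt_line x a t)

theorem differentiableAt_fderiv (hu : ContDiffAt ℝ 2 u x) : DifferentiableAt ℝ (fderiv ℝ u) x :=
  (hu.fderiv_right (m := 1) (by norm_num)).differentiableAt (by simp)

theorem hasDerivAt_fderiv_line (hu : ContDiffAt ℝ 2 u x) (a v : E) :
    HasDerivAt (fun t : ℝ => fderiv ℝ u (x + t • a) v) (fderiv ℝ (fderiv ℝ u) x a v) 0 := by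
  have h1 : HasFDerivAt (fderiv ℝ u) (fderiv ℝ (fderiv ℝ u) x) (x + (0 : ℝ) • a) := by
    simpa using (differentiableAt_fderiv hu).hasFDerivAt
  have h2 := h1.comp_hasDerivAt 0 (hasDerivAt_line x a 0)
  exact h2.clm_apply (hasDerivAt_const 0 v) |>.congr_deriv (by simp)

variable {κ : Fin n → ℝ}

/-! ### Comparison with spheres and horospheres. -/

/-- Comparison with a Euclidean sphere with centre `(c, h)` and radius `r` whose complement
contains the graph near `x` and which contains the point above `x`. -/
theorem sphere_touching (hC : ContDiffAt ℝ 2 u x) {c : E} {h r : ℝ}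
    (hmax : IsLocalMax (fun y => r ^ 2 - ‖y - c‖ ^ 2 - (u y - h) ^ 2) x)
    (h0 : r ^ 2 - ‖x - c‖ ^ 2 - (u x - h) ^ 2 = 0) :
    (∀ a, 0 ≤ ⟪a, a⟫_ℝ + fderiv ℝ u x a * fderiv ℝ u x a
      + (u x - h) * fderiv ℝ (fderiv ℝ u) x a a) ∧
    ((u x - h) * slopeFactor u x) ^ 2 = r ^ 2 := by
  have key : ∀ a : E, ⟪x - c, a⟫_ℝ + (u x - h) * fderiv ℝ u x a = 0 ∧
      0 ≤ ⟪a, a⟫_ℝ + fderiv ℝ u x a * fderiv ℝ u x a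
      + (u x - h) * fderiv ℝ (fderiv ℝ u) x a a := fun a => by
    have hm : IsLocalMax (fun t : ℝ => r ^ 2 - ‖x + t • a - c‖ ^ 2 - (u (x + t • a) - h) ^ 2) 0 := by
      have := (tendsto_line x a).eventually hmax
      simpa [IsLocalMax, IsMaxFilter] using this
    have hd : ∀ t : ℝ, HasDerivAt (fun t : ℝ => x + t • a - c) a t := fun t =>
      (hasDerivAt_line x a t).sub_const c
    obtain ⟨h1, h2⟩ := second_deriv_nonpos_of_isLocalMax
      (g' := fun t => -(2 * ⟪x + t • a - c, a⟫_ℝ)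
        - 2 * ((u (x + t • a) - h) * fderiv ℝ u (x + t • a) a))
      (L := -(2 * ⟪a, a⟫_ℝ) - 2 * (fderiv ℝ u x a * fderiv ℝ u x a
        + (u x - h) * fderiv ℝ (fderiv ℝ u) x a a)) hm
      (by
        filter_upwards [hasDerivAt_comp_line hC a] with t ht
        refine ((((hd t).norm_sq).const_sub _).sub ((ht.sub_const h).pow 2)).congr_deriv ?_
        simp
        ring)
      (by
        have e1 := ((hd 0).inner ℝ (hasDerivAt_const 0 a)).const_mul 2
        have e2 := (((hasDerivAt_comp_line hC a).self_of_nhds.sub_const h).mul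
          (hasDerivAt_fderiv_line hC a a)).const_mul 2
        refine (e1.neg.sub e2).congr_deriv ?_
        simp)
    simp only [zero_smul, add_zero] at h1
    constructor <;> linarith
  refine ⟨fun a => (key a).2, ?_⟩
  -- By the first-order condition the centre lies on the Euclidean normal line of the graph.
  have hg : x - c = -(u x - h) • ∇ u x := by
    refine ext_inner_right ℝ fun a => ?_
    rw [inner_smul_left, inner_gradient]
    have := (key a).1
    simp only [RCLike.conj_to_real]
    linarith
  rw [hg, norm_smul, mul_pow, Real.norm_eq_abs, sq_abs] at h0
  rw [mul_pow, slopeFactor_sq]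
  linarith

theorem IsPrincipalCurvatures.exists_normal_vector (hκ : IsPrincipalCurvatures u x κ)
    (hu : 0 < u x) (i : Fin n) :
    ∃ a : E, ⟪a, a⟫_ℝ + fderiv ℝ u x a * fderiv ℝ u x a = u x ^ 2 ∧
      κ i = (fderiv ℝ (fderiv ℝ u) x a a / u x + 1) / slopeFactor u x := by
  obtain ⟨v, hv⟩ := hκ
  obtain ⟨h1, h2⟩ := hv i i
  rw [if_pos rfl] at h1 h2
  refine ⟨v i, ?_, ?_⟩
  · rw [firstForm_eq, div_eq_one_iff_eq (by positivity)] at h1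
    exact h1
  · rw [← h2, secondForm_eq _ _ _ _ hu, h1]

/-- A Euclidean sphere is umbilic, of hyperbolic curvature h/r for the inward normal. On the upper
cap the upward normal is outward, giving -h/r, and a graph touching the cap from above is at least
as curved. -/
theorem le_curvature_of_sphere_above (hκ : IsPrincipalCurvatures u x κ) (hu : 0 < u x)
    (hC : ContDiffAt ℝ 2 u x) {c : E} {h r : ℝ} (hr : 0 < r)
    (hmax : IsLocalMax (fun y => r ^ 2 - ‖y - c‖ ^ 2 - (u y - h) ^ 2) x)
    (h0 : r ^ 2 - ‖x - c‖ ^ 2 - (u x - h) ^ 2 = 0) (huh : h < u x) (i : Fin n) :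
    -h / r ≤ κ i := by
  obtain ⟨h1, h2⟩ := sphere_touching hC hmax h0
  obtain ⟨a, ha, hκ⟩ := hκ.exists_normal_vector hu i
  have hw := slopeFactor_pos u x
  have hpos : 0 < u x - h := sub_pos.2 huh
  rw [sq_eq_sq₀ (by positivity) hr.le] at h2
  have h3 := h1 a
  rw [ha] at h3
  rw [hκ, ← h2, div_le_div_iff₀ (by positivity) hw]
  have h4 : -h * u x ≤ (fderiv ℝ (fderiv ℝ u) x a a + u x) * (u x - h) := by nlinarith
  have h5 : -h ≤ (fderiv ℝ (fderiv ℝ u) x a a / u x + 1) * (u x - h) := by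
    rw [div_add_one hu.ne', div_mul_eq_mul_div, le_div_iff₀ hu]
    exact h4
  nlinarith

/-- On the lower cap the upward normal is inward, so the sphere has curvature h/r, and a graph
touching it from below is at most as curved. -/
theorem curvature_le_of_sphere_below (hκ : IsPrincipalCurvatures u x κ) (hu : 0 < u x)
    (hC : ContDiffAt ℝ 2 u x) {c : E} {h r : ℝ} (hr : 0 < r)
    (hmax : IsLocalMax (fun y => r ^ 2 - ‖y - c‖ ^ 2 - (u y - h) ^ 2) x)
    (h0 : r ^ 2 - ‖x - c‖ ^ 2 - (u x - h) ^ 2 = 0) (huh : u x < h) (i : Fin n) :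
    κ i ≤ h / r := by
  obtain ⟨h1, h2⟩ := sphere_touching hC hmax h0
  obtain ⟨a, ha, hκ⟩ := hκ.exists_normal_vector hu i
  have hw := slopeFactor_pos u x
  have hpos : 0 < h - u x := sub_pos.2 huh
  rw [← neg_sq, ← neg_mul, neg_sub, sq_eq_sq₀ (by positivity) hr.le] at h2
  have h3 := h1 a
  rw [ha] at h3
  rw [hκ, ← h2, div_le_div_iff₀ hw (by positivity)]
  have h4 : (fderiv ℝ (fderiv ℝ u) x a a + u x) * (h - u x) ≤ h * u x := by nlinarith
  have h5 : (fderiv ℝ (fderiv ℝ u) x a a / u x + 1) * (h - u x) ≤ h := by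
    rw [div_add_one hu.ne', div_mul_eq_mul_div, div_le_iff₀ hu]
    exact h4
  nlinarith

theorem fderiv_fderiv_nonpos_of_isLocalMax (hC : ContDiffAt ℝ 2 u x) (hmax : IsLocalMax u x)
    (a : E) : fderiv ℝ (fderiv ℝ u) x a a ≤ 0 := by
  have hm : IsLocalMax (fun t : ℝ => u (x + t • a)) 0 := by
    have := (tendsto_line x a).eventually hmax
    simpa [IsLocalMax, IsMaxFilter] using this
  exact (second_deriv_nonpos_of_isLocalMax hm (hasDerivAt_comp_line hC a)
    (hasDerivAt_fderiv_line hC a a)).2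

theorem slopeFactor_eq_one (h : fderiv ℝ u x = 0) : slopeFactor u x = 1 := by
  simp [slopeFactor, gradient, h]

/-- The horizontal horosphere through the point has all curvatures 1 for the upward normal, and the
graph touches it from below. -/
theorem curvature_le_one_of_isLocalMax (hκ : IsPrincipalCurvatures u x κ) (hu : 0 < u x)
    (hC : ContDiffAt ℝ 2 u x) (hmax : IsLocalMax u x) (i : Fin n) : κ i ≤ 1 := by
  obtain ⟨a, -, hκ⟩ := hκ.exists_normal_vector hu i
  rw [hκ, slopeFactor_eq_one hmax.fderiv_eq_zero, div_one]
  have := div_nonpos_of_nonpos_of_nonneg (fderiv_fderiv_nonpos_of_isLocalMax hC hmax a) hu.le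
  linarith

theorem one_le_curvature_of_isLocalMin (hκ : IsPrincipalCurvatures u x κ) (hu : 0 < u x)
    (hC : ContDiffAt ℝ 2 u x) (hmin : IsLocalMin u x) (i : Fin n) : 1 ≤ κ i := by
  obtain ⟨a, -, hκ⟩ := hκ.exists_normal_vector hu i
  have hm : IsLocalMax (fun t : ℝ => -u (x + t • a)) 0 := by
    have := (tendsto_line x a).eventually hmin
    simpa [IsLocalMax, IsMaxFilter] using this
  have h1 := (second_deriv_nonpos_of_isLocalMax hm
    ((hasDerivAt_comp_line hC a).mono fun t ht => ht.neg) (hasDerivAt_fderiv_line hC a a).neg).2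
  rw [hκ, slopeFactor_eq_one hmin.fderiv_eq_zero, div_one]
  have := div_nonneg (neg_nonpos.1 h1) hu.le
  linarith

end HyperbolicGraph

namespace HyperbolicGraph

/-! ### The depth of a graph below the tangent hyperplanes of another graph -/

variable {n : ℕ}

local notation "E" => EuclideanSpace ℝ (Fin n)

/-- The second derivative of `u` at `z` in the direction `b`, as a vector. -/
noncomputable def hessVec (u : E → ℝ) (z b : E) : E :=
  (InnerProductSpace.toDual ℝ E).symm (fderiv ℝ (fderiv ℝ u) z b)

/-- Half the second derivative of `u² + |·|²` at `z` in the direction `b`, as a vector. -/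
noncomputable def convexVec (u : E → ℝ) (z b : E) : E :=
  b + ⟪∇ u z, b⟫_ℝ • ∇ u z + u z • hessVec u z b

/-- The hyperbolic sine of the depth of the point of the graph of `u₁` above `x` below the
totally geodesic hyperplane tangent to the graph of `u₂` above `z` exceeds `S` if and only if this
is positive. -/
noncomputable def depthExcess (S : ℝ) (u₁ u₂ : E → ℝ) (x z : E) : ℝ :=
  u₂ z ^ 2 - ‖x - z‖ ^ 2 + 2 * u₂ z * ⟪∇ u₂ z, x - z⟫_ℝ - u₁ x ^ 2
    - 2 * S * u₂ z * slopeFactor u₂ z * u₁ x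

/-- Half the derivative of `depthExcess S u₁ u₂ x z` in the direction `z` is the inner product of
this with `convexVec`. -/
noncomputable def footDefect (S : ℝ) (u₁ u₂ : E → ℝ) (x z : E) : E :=
  x - z - (S * u₁ x / slopeFactor u₂ z) • ∇ u₂ z

theorem inner_hessVec (u : E → ℝ) (z b v : E) :
    ⟪hessVec u z b, v⟫_ℝ = fderiv ℝ (fderiv ℝ u) z b v := by
  rw [hessVec, InnerProductSpace.toDual_symm_apply]

variable {u u₁ u₂ : EuclideanSpace ℝ (Fin n) → ℝ} {x z : EuclideanSpace ℝ (Fin n)}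

theorem hasDerivAt_gradient_line (hu : ContDiffAt ℝ 2 u z) (b : E) :
    ∀ᶠ t : ℝ in 𝓝 0,
      HasDerivAt (fun t : ℝ => ∇ u (z + t • b)) (hessVec u (z + t • b) b) t := by
  filter_upwards [(tendsto_line z b).eventually (eventually_contDiffAt hu)] with t ht
  have h1 := (differentiableAt_fderiv ht).hasFDerivAt.comp_hasDerivAt t (hasDerivAt_line z b t)
  exact ((InnerProductSpace.toDual ℝ E).symm.toContinuousLinearEquiv.toContinuousLinearMap
    |>.hasFDerivAt).comp_hasDerivAt t h1

theorem hasDerivAt_slopeFactor_line {b : E} {t : ℝ}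
    (h : HasDerivAt (fun t : ℝ => ∇ u (z + t • b)) (hessVec u (z + t • b) b) t) :
    HasDerivAt (fun t : ℝ => slopeFactor u (z + t • b))
      (⟪∇ u (z + t • b), hessVec u (z + t • b) b⟫_ℝ / slopeFactor u (z + t • b)) t := by
  have h1 : (1 : ℝ) + ‖∇ u (z + t • b)‖ ^ 2 ≠ 0 := by positivity
  refine (((h.norm_sq).const_add 1).sqrt h1).congr_deriv ?_
  rw [slopeFactor, mul_div_mul_left _ _ two_ne_zero]

/-- The grouping of terms is the point: second derivatives of `u₂` enter only through `convexVec`,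
paired with `footDefect`, so the whole can be differentiated once more wherever `footDefect`
vanishes. -/
theorem hasDerivAt_depthExcess_line (S : ℝ) (h₁ : ContDiffAt ℝ 2 u₁ x) (h₂ : ContDiffAt ℝ 2 u₂ z)
    (a b : E) : ∀ᶠ t : ℝ in 𝓝 0,
      HasDerivAt (fun t : ℝ => depthExcess S u₁ u₂ (x + t • a) (z + t • b))
        (2 * ⟪convexVec u₂ (z + t • b) b, footDefect S u₁ u₂ (x + t • a) (z + t • b)⟫_ℝ
          + 2 * (⟪z + t • b - (x + t • a) + u₂ (z + t • b) • ∇ u₂ (z + t • b), a⟫_ℝ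
            - (u₁ (x + t • a) + S * u₂ (z + t • b) * slopeFactor u₂ (z + t • b))
              * fderiv ℝ u₁ (x + t • a) a)) t := by
  filter_upwards [hasDerivAt_comp_line h₁ a, hasDerivAt_comp_line h₂ b,
    hasDerivAt_gradient_line h₂ b] with t e1 e2 e3
  have e4 := hasDerivAt_slopeFactor_line e3
  have e5 := (hasDerivAt_line x a t).sub (hasDerivAt_line z b t)
  have := ((((e2.pow 2).sub e5.norm_sq).add ((e2.const_mul 2).mul (e3.inner ℝ e5))).sub
    (e1.pow 2)).sub ((((e2.const_mul (2 * S)).mul e4)).mul e1)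
  refine HasDerivAt.congr_deriv (f := fun t : ℝ => depthExcess S u₁ u₂ (x + t • a) (z + t • b))
    this ?_
  have hw := (slopeFactor_pos u₂ (z + t • b)).ne'
  have hw2 := slopeFactor_sq u₂ (z + t • b)
  rw [← inner_gradient u₂]
  simp only [convexVec, footDefect, Pi.sub_apply, Pi.mul_apply]
  generalize x + t • a = X at *
  generalize z + t • b = Z at *
  generalize slopeFactor u₂ Z = w at *
  generalize ∇ u₂ Z = g at *
  generalize hessVec u₂ Z b = K at *
  simp only [inner_add_left, inner_sub_left, inner_sub_right, inner_smul_left,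
    inner_smul_right, RCLike.conj_to_real, real_inner_self_eq_norm_sq, real_inner_comm g b,
    real_inner_comm g K, real_inner_comm b X, real_inner_comm b Z, real_inner_comm a X,
    real_inner_comm a Z]
  have e : ‖g‖ ^ 2 = w ^ 2 - 1 := by linarith
  rw [e]
  field_simp
  ring

theorem isLocalMax_line {F : E × E → ℝ} (h : IsLocalMax F (x, z)) (a b : E) :
    IsLocalMax (fun t : ℝ => F (x + t • a, z + t • b)) 0 := by
  have := ((tendsto_line x a).prodMk_nhds (tendsto_line z b)).eventually h
  simpa [IsLocalMax, IsMaxFilter] using this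

theorem hasDerivAt_footDefect_line (S : ℝ) (h₁ : ContDiffAt ℝ 2 u₁ x) (h₂ : ContDiffAt ℝ 2 u₂ z)
    (a b : E) : HasDerivAt (fun t : ℝ => footDefect S u₁ u₂ (x + t • a) (z + t • b))
      (a - b - ((S * fderiv ℝ u₁ x a / slopeFactor u₂ z) • ∇ u₂ z
        + (S * u₁ x / slopeFactor u₂ z) • (hessVec u₂ z b
          - (⟪∇ u₂ z, hessVec u₂ z b⟫_ℝ / slopeFactor u₂ z ^ 2) • ∇ u₂ z))) 0 := by
  have e1 := (hasDerivAt_comp_line h₁ a).self_of_nhds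
  have e3 := (hasDerivAt_gradient_line h₂ b).self_of_nhds
  have e4 := hasDerivAt_slopeFactor_line e3
  have e5 := (hasDerivAt_line x a 0).sub (hasDerivAt_line z b 0)
  have hw := (slopeFactor_pos u₂ (z + (0 : ℝ) • b)).ne'
  have := e5.sub (((e1.const_mul S).div e4 hw).smul e3)
  refine HasDerivAt.congr_deriv (f := fun t : ℝ => footDefect S u₁ u₂ (x + t • a) (z + t • b))
    this ?_
  simp only [zero_smul, add_zero, Pi.div_apply] at hw ⊢
  match_scalars <;> field_simp
  ring

theorem continuousAt_convexVec_line (h₂ : ContDiffAt ℝ 2 u₂ z) (b : E) :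
    ContinuousAt (fun t : ℝ => convexVec u₂ (z + t • b) b) 0 := by
  have e2 := (hasDerivAt_comp_line h₂ b).self_of_nhds.continuousAt
  have e3 := (hasDerivAt_gradient_line h₂ b).self_of_nhds.continuousAt
  have h3 : ContinuousAt (fderiv ℝ (fderiv ℝ u₂)) (z + (0 : ℝ) • b) := by
    rw [zero_smul, add_zero]
    have h1 : ContDiffAt ℝ 1 (fderiv ℝ u₂) z := h₂.fderiv_right (by norm_num)
    exact h1.continuousAt_fderiv (by simp)
  have h4 : ContinuousAt (fun t : ℝ => hessVec u₂ (z + t • b) b) 0 := by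
    have h5 : ContinuousAt (fun t : ℝ => fderiv ℝ (fderiv ℝ u₂) (z + t • b) b) 0 :=
      (h3.comp (f := fun t : ℝ => z + t • b) (hasDerivAt_line z b 0).continuousAt).clm_apply
        continuousAt_const
    have h6 : Continuous fun l : StrongDual ℝ E => (InnerProductSpace.toDual ℝ E).symm l :=
      (InnerProductSpace.toDual ℝ E).symm.continuous
    exact h6.continuousAt.comp (f := fun t : ℝ => fderiv ℝ (fderiv ℝ u₂) (z + t • b) b) h5
  have h7 : ContinuousAt (fun t : ℝ => ⟪∇ u₂ (z + t • b), b⟫_ℝ) 0 :=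
    e3.inner (𝕜 := ℝ) continuousAt_const
  simp only [convexVec]
  exact (continuousAt_const.add (h7.smul e3)).add (e2.smul h4)

/-- First order conditions at a local maximum of `depthExcess`. -/
theorem depthExcess_first_order {S : ℝ} (h₁ : ContDiffAt ℝ 2 u₁ x) (h₂ : ContDiffAt ℝ 2 u₂ z)
    (hpos : ∀ b, b ≠ 0 → 0 < ⟪convexVec u₂ z b, b⟫_ℝ)
    (hmax : IsLocalMax (fun p : E × E => depthExcess S u₁ u₂ p.1 p.2) (x, z)) :
    footDefect S u₁ u₂ x z = 0 ∧
      z - x + u₂ z • ∇ u₂ z = (u₁ x + S * u₂ z * slopeFactor u₂ z) • ∇ u₁ x := by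
  have key : ∀ a b : E, ⟪convexVec u₂ z b, footDefect S u₁ u₂ x z⟫_ℝ
      + (⟪z - x + u₂ z • ∇ u₂ z, a⟫_ℝ
        - (u₁ x + S * u₂ z * slopeFactor u₂ z) * fderiv ℝ u₁ x a) = 0 := fun a b => by
    have h := (isLocalMax_line hmax a b).hasDerivAt_eq_zero
      (hasDerivAt_depthExcess_line S h₁ h₂ a b).self_of_nhds
    simp only [zero_smul, add_zero] at h
    linarith
  have h0 : footDefect S u₁ u₂ x z = 0 := by
    by_contra h
    -- Testing in the direction of the defect itself: the positive definite convexity form gives it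
    -- a positive derivative unless it is zero.
    have h3 := key 0 (footDefect S u₁ u₂ x z)
    have h4 := hpos _ h
    simp at h3
    linarith
  refine ⟨h0, ext_inner_right ℝ fun a => ?_⟩
  have h3 := key a 0
  rw [h0, inner_zero_right] at h3
  rw [inner_smul_left, inner_gradient, RCLike.conj_to_real]
  linarith

/-- Second order condition at a local maximum of `depthExcess`. -/
theorem depthExcess_second_order {S : ℝ} (h₁ : ContDiffAt ℝ 2 u₁ x) (h₂ : ContDiffAt ℝ 2 u₂ z)
    (hfoot : footDefect S u₁ u₂ x z = 0)
    (hmax : IsLocalMax (fun p : E × E => depthExcess S u₁ u₂ p.1 p.2) (x, z)) (a b : E) :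
    ⟪convexVec u₂ z b, (2 : ℝ) • (a - (S / slopeFactor u₂ z * fderiv ℝ u₁ x a) • ∇ u₂ z) - b
      - (S * u₁ x / slopeFactor u₂ z) • (hessVec u₂ z b
          - (⟪∇ u₂ z, hessVec u₂ z b⟫_ℝ / slopeFactor u₂ z ^ 2) • ∇ u₂ z)⟫_ℝ
      ≤ ⟪a, a⟫_ℝ + fderiv ℝ u₁ x a * fderiv ℝ u₁ x a
        + (u₁ x + S * u₂ z * slopeFactor u₂ z) * fderiv ℝ (fderiv ℝ u₁) x a a := by
  have e1 := (hasDerivAt_comp_line h₁ a).self_of_nhds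
  have e2 := (hasDerivAt_comp_line h₂ b).self_of_nhds
  have e3 := (hasDerivAt_gradient_line h₂ b).self_of_nhds
  have e4 := hasDerivAt_slopeFactor_line e3
  have e5 := (hasDerivAt_line z b 0).sub (hasDerivAt_line x a 0)
  have e6 := hasDerivAt_fderiv_line h₁ a a
  -- `convexVec` is only continuous, but its partner vanishes at t = 0, so the product has a
  -- derivative there.
  have t1 := hasDerivAt_inner_of_eq_zero (continuousAt_convexVec_line h₂ b)
    (hasDerivAt_footDefect_line S h₁ h₂ a b) (by simpa using hfoot)
  have t2 := ((e5.add (e2.smul e3)).inner ℝ (hasDerivAt_const (0 : ℝ) a)).sub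
    ((e1.add ((e2.const_mul S).mul e4)).mul e6)
  have h := (second_deriv_nonpos_of_isLocalMax (isLocalMax_line hmax a b)
    (hasDerivAt_depthExcess_line S h₁ h₂ a b) ((t1.const_mul 2).add (t2.const_mul 2))).2
  have hw := (slopeFactor_pos u₂ z).ne'
  have hw2 := slopeFactor_sq u₂ z
  simp only [zero_smul, add_zero, Pi.add_apply, Pi.smul_apply', Pi.sub_apply, Pi.mul_apply,
    inner_zero_right] at h
  rw [← inner_gradient u₂] at h
  simp only [convexVec] at h ⊢
  generalize fderiv ℝ (fderiv ℝ u₁) x a a = H at *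
  generalize fderiv ℝ u₁ x a = p at *
  generalize slopeFactor u₂ z = w at *
  generalize ∇ u₂ z = g at *
  generalize hessVec u₂ z b = K at *
  simp only [inner_add_left, inner_sub_left, inner_add_right, inner_sub_right, inner_smul_left,
    inner_smul_right, RCLike.conj_to_real, real_inner_self_eq_norm_sq, real_inner_comm g b,
    real_inner_comm g K, real_inner_comm b K, real_inner_comm a K] at h ⊢
  have e : ‖g‖ ^ 2 = w ^ 2 - 1 := by linarith
  rw [e] at h ⊢
  linear_combination (norm := skip) (1 / 2) * h
  apply le_of_eq
  field_simp
  ring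

end HyperbolicGraph

namespace HyperbolicGraph

/-! ### Comparison of the principal curvatures at a local maximum of the depth -/

variable {n : ℕ}

local notation "E" => EuclideanSpace ℝ (Fin n)

variable {u u₁ u₂ : EuclideanSpace ℝ (Fin n) → ℝ} {x z : EuclideanSpace ℝ (Fin n)}

/-- Up to a positive factor, the second fundamental form is the Euclidean Hessian of (u² + |·|²)/2.
Local hyperbolic convexity of the graph thus becomes ordinary convexity of u² + |·|² along segments
in Ω. -/
theorem inner_convexVec (hu : 0 < u z) (b y : E) :
    ⟪convexVec u z b, y⟫_ℝ = u z ^ 2 * slopeFactor u z * secondForm u z b y := by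
  have hw := (slopeFactor_pos u z).ne'
  rw [secondForm_eq _ _ _ _ hu, firstForm_eq, convexVec]
  simp only [inner_add_left, inner_smul_left, inner_hessVec, RCLike.conj_to_real,
    inner_gradient]
  field_simp
  ring

theorem firstForm_sum_left {ι : Type*} (s : Finset ι) (c : ι → ℝ) (v : ι → E) (y : E) :
    firstForm u z (∑ j ∈ s, c j • v j) y = ∑ j ∈ s, c j * firstForm u z (v j) y := by
  simp only [firstForm_eq, sum_inner, map_sum, map_smul, inner_smul_left, RCLike.conj_to_real,
    smul_eq_mul, Finset.sum_mul, ← Finset.sum_add_distrib, Finset.sum_div]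
  exact Finset.sum_congr rfl fun j _ => by ring

theorem secondForm_sum_left (hu : 0 < u z) {ι : Type*} (s : Finset ι) (c : ι → ℝ) (v : ι → E)
    (y : E) :
    secondForm u z (∑ j ∈ s, c j • v j) y = ∑ j ∈ s, c j * secondForm u z (v j) y := by
  simp only [secondForm_eq _ _ _ _ hu, firstForm_sum_left, map_sum, map_smul,
    sum_apply, smul_apply,
    smul_eq_mul, ← Finset.sum_add_distrib, Finset.sum_div]
  exact Finset.sum_congr rfl fun j _ => by ring

theorem firstForm_comm (u : E → ℝ) (z v y : E) : firstForm u z v y = firstForm u z y v := by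
  rw [firstForm_eq, firstForm_eq, real_inner_comm, mul_comm (fderiv ℝ u z v)]

/-- A frame that is orthonormal for the first fundamental form spans. -/
theorem eq_sum_firstForm {v : Fin n → E}
    (hv : ∀ i j, firstForm u z (v i) (v j) = if i = j then 1 else 0) (y : E) :
    y = ∑ j, firstForm u z y (v j) • v j := by
  have hli : LinearIndependent ℝ v := by
    rw [Fintype.linearIndependent_iff]
    intro c hc i
    have h := firstForm_sum_left (u := u) (z := z) Finset.univ c v (v i)
    rw [hc] at h
    simpa [hv, firstForm_eq] using h.symm
  have hspan : y ∈ Submodule.span ℝ (Set.range v) := by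
    rw [hli.span_eq_top_of_card_eq_finrank' (by simp)]
    trivial
  obtain ⟨c, rfl⟩ := (Submodule.mem_span_range_iff_exists_fun ℝ).1 hspan
  refine Finset.sum_congr rfl fun j _ => ?_
  rw [firstForm_sum_left]
  simp [hv]

theorem inner_convexVec_pos {κ : Fin n → ℝ} (hκ : IsPrincipalCurvatures u z κ) (hu : 0 < u z)
    (hpos : ∀ i, 0 < κ i) (b : E) (hb : b ≠ 0) : 0 < ⟪convexVec u z b, b⟫_ℝ := by
  obtain ⟨v, hv⟩ := hκ
  have hb' := eq_sum_firstForm (fun i j => (hv i j).1) b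
  set c := fun j => firstForm u z b (v j) with hc
  have h : secondForm u z b b = ∑ j, κ j * c j ^ 2 := by
    have h1 : ∀ j, secondForm u z (v j) b = κ j * c j := fun j => by
      have hs : secondForm u z (v j) b = ∑ i, c i * secondForm u z (v j) (v i) := by
        conv_lhs => rw [hb']
        simp only [secondForm_eq _ _ _ _ hu, firstForm_comm u z (v j), firstForm_sum_left,
          map_sum, map_smul, smul_eq_mul, ← Finset.sum_add_distrib, Finset.sum_div]
        exact Finset.sum_congr rfl fun j _ => by ring
      rw [hs]
      simp [(hv _ _).2, mul_comm]
    conv_lhs => rw [hb', secondForm_sum_left hu, ← hb']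
    exact Finset.sum_congr rfl fun j _ => by rw [h1]; ring
  rw [inner_convexVec hu, h]
  have hw := slopeFactor_pos u z
  refine mul_pos (by positivity) ?_
  obtain ⟨j, hj⟩ : ∃ j, c j ≠ 0 := by
    by_contra! h0
    exact hb (hb'.trans (Finset.sum_eq_zero fun j _ => smul_eq_zero_of_left (h0 j) _))
  exact Finset.sum_pos' (fun i _ => mul_nonneg (hpos i).le (sq_nonneg _))
    ⟨j, Finset.mem_univ _, mul_pos (hpos j) (by positivity)⟩

/-- The parallel transport from the point above `x` to the point above `z` along their common
normal geodesic. -/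
noncomputable def normalTransport (S C : ℝ) (u₁ u₂ : E → ℝ) (x z a : E) : E :=
  ((S + C * slopeFactor u₂ z) / slopeFactor u₂ z) •
    (a - (S / slopeFactor u₂ z * fderiv ℝ u₁ x a) • ∇ u₂ z)

/-- Parallel transport along the common normal is an isometry of the two tangent spaces; `hheight`
and `hg` encode that the geodesic is normal at both ends. -/
theorem firstForm_normalTransport {S C : ℝ} (hCS : C ^ 2 = 1 + S ^ 2)
    (hu₁ : 0 < u₁ x) (hu₂ : 0 < u₂ z)
    (hheight : u₂ z * slopeFactor u₂ z = u₁ x * (S + C * slopeFactor u₂ z))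
    (hg : ∇ u₂ z = (C + S * slopeFactor u₂ z) • ∇ u₁ x) (a b : E) :
    firstForm u₂ z (normalTransport S C u₁ u₂ x z a) (normalTransport S C u₁ u₂ x z b)
      = firstForm u₁ x a b := by
  have hw := slopeFactor_pos u₂ z
  have hw2 := slopeFactor_sq u₂ z
  have hQ : S + C * slopeFactor u₂ z = u₂ z * slopeFactor u₂ z / u₁ x := by
    rw [hheight]
    field_simp
  have hga : ∀ a, ⟪∇ u₂ z, a⟫_ℝ = (C + S * slopeFactor u₂ z) * fderiv ℝ u₁ x a := fun a => by
    rw [hg, inner_smul_left, inner_gradient, RCLike.conj_to_real]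
  simp only [firstForm_eq, ← inner_gradient u₂, normalTransport, hQ]
  simp only [inner_sub_left, inner_sub_right, inner_smul_left, inner_smul_right,
    RCLike.conj_to_real, real_inner_self_eq_norm_sq, real_inner_comm (∇ u₂ z) a]
  rw [hga a, hga b]
  have e : ‖∇ u₂ z‖ ^ 2 = slopeFactor u₂ z ^ 2 - 1 := by linarith
  rw [e]
  generalize slopeFactor u₂ z = w at *
  generalize fderiv ℝ u₁ x a = p at *
  generalize fderiv ℝ u₁ x b = q at *
  field_simp
  linear_combination (w ^ 2 * p * q) * hCS

/-- The relations between the heights and the slopes at the ends of a common normal geodesic. -/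
theorem normal_geodesic_relations {S C : ℝ} (hS : 0 ≤ S) (hC : 0 < C) (hCS : C ^ 2 = 1 + S ^ 2)
    (hu₁ : 0 < u₁ x) (hu₂ : 0 < u₂ z) (h0 : depthExcess S u₁ u₂ x z = 0)
    (hfoot : footDefect S u₁ u₂ x z = 0)
    (hgrad : z - x + u₂ z • ∇ u₂ z = (u₁ x + S * u₂ z * slopeFactor u₂ z) • ∇ u₁ x) :
    u₂ z * slopeFactor u₂ z = u₁ x * (S + C * slopeFactor u₂ z) ∧
      ∇ u₂ z = (C + S * slopeFactor u₂ z) • ∇ u₁ x ∧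
      slopeFactor u₁ x * (C + S * slopeFactor u₂ z) = S + C * slopeFactor u₂ z := by
  have hw := slopeFactor_pos u₂ z
  have hw2 := slopeFactor_sq u₂ z
  have hw1 := slopeFactor_pos u₁ x
  have hw12 := slopeFactor_sq u₁ x
  have he : x - z = (S * u₁ x / slopeFactor u₂ z) • ∇ u₂ z := sub_eq_zero.1 hfoot
  have hCltS : S < C := by
    by_contra! h
    nlinarith
  have h1 : u₂ z * slopeFactor u₂ z = u₁ x * (S + C * slopeFactor u₂ z) := by
    rw [depthExcess, he, norm_smul, inner_smul_right, mul_pow, real_inner_self_eq_norm_sq,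
      Real.norm_eq_abs, sq_abs, show ‖∇ u₂ z‖ ^ 2 = slopeFactor u₂ z ^ 2 - 1 by linarith] at h0
    have h2 : (u₂ z * slopeFactor u₂ z - S * u₁ x) ^ 2 = (u₁ x * C * slopeFactor u₂ z) ^ 2 := by
      field_simp at h0
      linear_combination h0 - u₁ x ^ 2 * slopeFactor u₂ z ^ 2 * hCS
    -- The other root would give u₂ w = u₁ (S - C w), which is not positive because S < C and w ≥ 1.
    rcases sq_eq_sq_iff_eq_or_eq_neg.1 h2 with h | h
    · linarith
    · have h3 : 1 ≤ slopeFactor u₂ z := by nlinarith [sq_nonneg ‖∇ u₂ z‖]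
      have h4 : 0 < u₂ z * slopeFactor u₂ z := by positivity
      have h5 : S * u₁ x ≤ u₁ x * C * slopeFactor u₂ z := by
        have := mul_le_mul hCltS.le h3 zero_le_one hC.le
        nlinarith
      linarith
  have h2 : ∇ u₂ z = (C + S * slopeFactor u₂ z) • ∇ u₁ x := by
    have h3 : (u₁ x * C) • ∇ u₂ z = (u₁ x * C) • ((C + S * slopeFactor u₂ z) • ∇ u₁ x) := by
      have e1 : z - x = -(S * u₁ x / slopeFactor u₂ z) • ∇ u₂ z := by
        rw [← neg_sub, he, neg_smul]
      rw [e1, ← add_smul] at hgrad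
      have e2 : -(S * u₁ x / slopeFactor u₂ z) + u₂ z = u₁ x * C := by
        field_simp
        linarith
      rw [e2] at hgrad
      rw [hgrad, smul_smul]
      congr 1
      linear_combination S * h1 - u₁ x * hCS
    exact smul_right_injective _ (by positivity : u₁ x * C ≠ 0) h3
  refine ⟨h1, h2, ?_⟩
  have h3 : ‖∇ u₂ z‖ ^ 2 = (C + S * slopeFactor u₂ z) ^ 2 * ‖∇ u₁ x‖ ^ 2 := by
    rw [h2, norm_smul, mul_pow, Real.norm_eq_abs, sq_abs]
  rw [← sq_eq_sq₀ (by positivity) (by positivity), mul_pow, hw12]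
  linear_combination -h3 - hw2 + (1 - slopeFactor u₂ z ^ 2) * hCS

/-- At a local maximum of the depth, the principal curvatures of the upper parallel surface are
dominated, after averaging, by those of the touching surface. -/
theorem exists_doublyStochastic_of_isLocalMax {S C : ℝ} (hS : 0 ≤ S) (hC : 0 < C)
    (hCS : C ^ 2 = 1 + S ^ 2) (h₁ : ContDiffAt ℝ 2 u₁ x) (h₂ : ContDiffAt ℝ 2 u₂ z)
    (hu₁ : 0 < u₁ x) (hu₂ : 0 < u₂ z) {κ₁ κ₂ : Fin n → ℝ}
    (hκ₁ : IsPrincipalCurvatures u₁ x κ₁) (hκ₂ : IsPrincipalCurvatures u₂ z κ₂)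
    (hpos : ∀ i, 0 < κ₂ i) (h0 : depthExcess S u₁ u₂ x z = 0)
    (hmax : IsLocalMax (fun p : E × E => depthExcess S u₁ u₂ p.1 p.2) (x, z)) :
    ∃ W ∈ doublyStochastic ℝ (Fin n),
      ∀ i, W.mulVec (fun j => (S + C * κ₂ j) / (C + S * κ₂ j)) i ≤ κ₁ i := by
  have hw := slopeFactor_pos u₂ z
  have hw2 := slopeFactor_sq u₂ z
  have hw1 := slopeFactor_pos u₁ x
  obtain ⟨hfoot, hgrad⟩ := depthExcess_first_order h₁ h₂ (inner_convexVec_pos hκ₂ hu₂ hpos) hmax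
  obtain ⟨hheight, hg, hslope⟩ := normal_geodesic_relations hS hC hCS hu₁ hu₂ h0 hfoot hgrad
  have hsecond := depthExcess_second_order h₁ h₂ hfoot hmax
  have hiso := firstForm_normalTransport hCS hu₁ hu₂ hheight hg
  obtain ⟨v, hv⟩ := hκ₁
  obtain ⟨e, he⟩ := hκ₂
  set w := slopeFactor u₂ z with hwdef
  have hden : ∀ j, 0 < C + S * κ₂ j := fun j => by
    have := mul_nonneg hS (hpos j).le
    linarith
  have hQ : 0 < S + C * w := by positivity
  let T : Fin n → E := fun i => normalTransport S C u₁ u₂ x z (v i)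
  -- Coordinates of the transported principal frame of the lower graph in the principal frame of the
  -- upper one. Both frames are orthonormal, so `O` is orthogonal and its squared entries form a
  -- doubly stochastic matrix.
  let O : Matrix (Fin n) (Fin n) ℝ := Matrix.of fun i j => firstForm u₂ z (T i) (e j)
  have hOO : O * O.transpose = 1 := by
    ext i k
    rw [Matrix.mul_apply, Matrix.one_apply, ← (hv i k).1, ← hiso]
    conv_rhs =>
      rw [firstForm_comm, eq_sum_firstForm (fun i j => (he i j).1) (normalTransport _ _ _ _ _ _ (v k)),
        firstForm_sum_left]
    refine Finset.sum_congr rfl fun j _ => ?_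
    change firstForm u₂ z (T i) (e j) * firstForm u₂ z (T k) (e j)
      = firstForm u₂ z (T k) (e j) * firstForm u₂ z (e j) (T i)
    rw [firstForm_comm u₂ z (e j), mul_comm]
  have hOO' : O.transpose * O = 1 := mul_eq_one_comm.1 hOO
  have hrow : ∀ i, ∑ j, O i j ^ 2 = 1 := fun i => by
    have := congr_fun (congr_fun hOO i) i
    simpa [Matrix.mul_apply, pow_two] using this
  have hcol : ∀ j, ∑ i, O i j ^ 2 = 1 := fun j => by
    have := congr_fun (congr_fun hOO' j) j
    simpa [Matrix.mul_apply, pow_two] using this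
  have key : ∀ i, ∑ j, κ₂ j * O i j ^ 2 / (C + S * κ₂ j) ≤ C * κ₁ i - S := fun i => by
    -- After normalization the second-order condition bounds ∑ κ_j β_j (2 O_ij - (C + S κ_j) β_j)
    -- for every motion b = ∑ β_j e_j of the foot point. This choice of β maximizes the sum: the
    -- Jacobi field C b + S A b along the normal, with A the shape operator (so `Ab` is A b), then
    -- equals the transported vector.
    set β : Fin n → ℝ := fun j => O i j / (C + S * κ₂ j) with hβ
    set b : E := ∑ j, β j • e j with hb
    set Ab : E := ∑ j, (κ₂ j * β j) • e j with hAb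
    have hII : ∀ y, ⟪convexVec u₂ z b, y⟫_ℝ
        = u₂ z ^ 2 * w * firstForm u₂ z Ab y := fun y => by
      rw [inner_convexVec hu₂, ← hwdef, firstForm_sum_left, hb, secondForm_sum_left hu₂]
      congr 1
      refine Finset.sum_congr rfl fun j _ => ?_
      have : secondForm u₂ z (e j) y = κ₂ j * firstForm u₂ z (e j) y := by
        conv_lhs => rw [eq_sum_firstForm (fun i j => (he i j).1) y]
        have hs : ∀ c : Fin n → ℝ, secondForm u₂ z (e j) (∑ k, c k • e k)
            = ∑ k, c k * secondForm u₂ z (e j) (e k) := fun c => by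
          simp only [secondForm_eq _ _ _ _ hu₂, firstForm_comm u₂ z (e j), firstForm_sum_left,
            map_sum, map_smul, smul_eq_mul, ← Finset.sum_add_distrib, Finset.sum_div]
          exact Finset.sum_congr rfl fun j _ => by ring
        rw [hs]
        simp [(he _ _).2, mul_comm, firstForm_comm u₂ z y]
      rw [this]
      ring
    have hM : convexVec u₂ z b = w • (Ab + ⟪∇ u₂ z, Ab⟫_ℝ • ∇ u₂ z) := by
      refine ext_inner_right ℝ fun y => ?_
      rw [hII, firstForm_eq, inner_smul_left, inner_add_left, inner_smul_left, inner_gradient,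
        inner_gradient]
      simp only [RCLike.conj_to_real]
      field_simp
    have hvec : (2 : ℝ) • (v i - (S / w * fderiv ℝ u₁ x (v i)) • ∇ u₂ z) - b
        - (S * u₁ x / w) • (hessVec u₂ z b
          - (⟪∇ u₂ z, hessVec u₂ z b⟫_ℝ / w ^ 2) • ∇ u₂ z)
        = (w / (S + C * w)) • ((2 : ℝ) • T i - (C • b + S • Ab)) := by
      have e1 : u₂ z • hessVec u₂ z b
          = w • (Ab + ⟪∇ u₂ z, Ab⟫_ℝ • ∇ u₂ z) - b - ⟪∇ u₂ z, b⟫_ℝ • ∇ u₂ z := by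
        rw [← hM, convexVec]
        abel
      have e2 : hessVec u₂ z b - (⟪∇ u₂ z, hessVec u₂ z b⟫_ℝ / w ^ 2) • ∇ u₂ z
          = (1 / u₂ z) • (w • Ab - b) := by
        have e3 : hessVec u₂ z b = (1 / u₂ z) •
            (w • (Ab + ⟪∇ u₂ z, Ab⟫_ℝ • ∇ u₂ z) - b - ⟪∇ u₂ z, b⟫_ℝ • ∇ u₂ z) := by
          rw [← e1, smul_smul, one_div_mul_cancel hu₂.ne', one_smul]
        rw [e3]
        simp only [inner_smul_right, inner_sub_right, inner_add_right,
          real_inner_self_eq_norm_sq, show ‖∇ u₂ z‖ ^ 2 = w ^ 2 - 1 by linarith]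
        match_scalars <;> field_simp
        ring
      have e4 : S * u₁ x / w * (1 / u₂ z) = S / (S + C * w) := by
        field_simp
        linear_combination -S * hheight
      rw [e2, smul_smul, e4]
      simp only [T, normalTransport, ← hwdef]
      match_scalars <;> field_simp
      ring
    have h := hsecond (v i) b
    rw [hvec, inner_smul_right, hII, firstForm_sum_left] at h
    have hsum : ∑ j, κ₂ j * β j * firstForm u₂ z (e j) ((2 : ℝ) • T i - (C • b + S • Ab))
        = ∑ j, κ₂ j * O i j ^ 2 / (C + S * κ₂ j) := by
      refine Finset.sum_congr rfl fun j _ => ?_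
      have hlin : firstForm u₂ z (e j) ((2 : ℝ) • T i - (C • b + S • Ab))
          = 2 * firstForm u₂ z (T i) (e j) - (C * firstForm u₂ z b (e j)
            + S * firstForm u₂ z Ab (e j)) := by
        rw [firstForm_comm u₂ z (e j)]
        simp only [firstForm_eq, inner_sub_left, inner_add_left, inner_smul_left, map_sub, map_add,
          map_smul, RCLike.conj_to_real, smul_eq_mul]
        ring
      have hb1 : firstForm u₂ z b (e j) = β j := by
        rw [hb, firstForm_sum_left]
        simp [(he _ _).1]
      have hb2 : firstForm u₂ z Ab (e j) = κ₂ j * β j := by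
        rw [hAb, firstForm_sum_left]
        simp [(he _ _).1]
      have hO : firstForm u₂ z (T i) (e j) = O i j := rfl
      rw [hlin, hb1, hb2, hO]
      have hD : β j * (C + S * κ₂ j) = O i j := div_mul_cancel₀ _ (hden j).ne'
      rw [eq_div_iff (hden j).ne', ← hD]
      ring
    rw [hsum] at h
    have hI : ⟪v i, v i⟫_ℝ + fderiv ℝ u₁ x (v i) * fderiv ℝ u₁ x (v i) = u₁ x ^ 2 := by
      have := (hv i i).1
      rwa [if_pos rfl, firstForm_eq, div_eq_one_iff_eq (by positivity)] at this
    have hH : fderiv ℝ (fderiv ℝ u₁) x (v i) (v i)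
        = u₁ x * (slopeFactor u₁ x * κ₁ i - 1) := by
      have := (hv i i).2
      rw [if_pos rfl, secondForm_eq _ _ _ _ hu₁, (hv i i).1, if_pos rfl] at this
      rw [← this]
      field_simp
      ring
    rw [hI, hH] at h
    set q := ∑ j, κ₂ j * O i j ^ 2 / (C + S * κ₂ j)
    have hl : w / (S + C * w) * (u₂ z ^ 2 * w * q) = u₁ x ^ 2 * (S + C * w) * q := by
      field_simp
      linear_combination q * (u₂ z * w + u₁ x * (S + C * w)) * hheight
    have hr : u₁ x ^ 2 + (u₁ x + S * u₂ z * w) * (u₁ x * (slopeFactor u₁ x * κ₁ i - 1))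
        = u₁ x ^ 2 * (S + C * w) * (C * κ₁ i - S) := by
      linear_combination (S * u₁ x * (slopeFactor u₁ x * κ₁ i - 1)) * hheight
        - u₁ x ^ 2 * slopeFactor u₁ x * κ₁ i * hCS + u₁ x ^ 2 * C * κ₁ i * hslope
    rw [hl, hr] at h
    exact le_of_mul_le_mul_left h (by positivity)
  refine ⟨Matrix.of fun i j => O i j ^ 2,
    mem_doublyStochastic_iff_sum.2 ⟨fun i j => ?_, by simpa using hrow, by simpa using hcol⟩,
    fun i => ?_⟩
  · rw [Matrix.of_apply]
    exact sq_nonneg _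
  change ∑ j, O i j ^ 2 * ((S + C * κ₂ j) / (C + S * κ₂ j)) ≤ κ₁ i
  refine le_of_mul_le_mul_left ?_ hC
  -- Since C² = 1 + S², one has C (S + Cκ)/(C + Sκ) = S + κ/(C + Sκ).
  have h1 : C * ∑ j, O i j ^ 2 * ((S + C * κ₂ j) / (C + S * κ₂ j))
      = S * ∑ j, O i j ^ 2 + ∑ j, κ₂ j * O i j ^ 2 / (C + S * κ₂ j) := by
    rw [Finset.mul_sum, Finset.mul_sum, ← Finset.sum_add_distrib]
    refine Finset.sum_congr rfl fun j _ => ?_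
    have := (hden j).ne'
    field_simp
    linear_combination O i j ^ 2 * κ₂ j * hCS
  rw [h1, hrow, mul_one]
  linarith [key i]

end HyperbolicGraph

namespace HyperbolicGraph

/-! ### Barriers at the asymptotic boundary -/

variable {n : ℕ}

local notation "E" => EuclideanSpace ℝ (Fin n)

variable {f : (Fin n → ℝ) → ℝ} {Ω : Set (EuclideanSpace ℝ (Fin n))}
  {u u₁ u₂ : EuclideanSpace ℝ (Fin n) → ℝ} {x : EuclideanSpace ℝ (Fin n)}

theorem IsStrictlyLocallyConvexGraph.contDiffAt (h : IsStrictlyLocallyConvexGraph Ω u)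
    (hΩ : IsOpen Ω) (hx : x ∈ Ω) : ContDiffAt ℝ 2 u x :=
  h.contDiffOn.contDiffAt (hΩ.mem_nhds hx)

theorem IsStrictlyLocallyConvexGraph.isPrincipalCurvatures
    (h : IsStrictlyLocallyConvexGraph Ω u) (hΩ : IsOpen Ω) (hx : x ∈ Ω) :
    IsPrincipalCurvatures u x (principalCurvatures u x) :=
  isPrincipalCurvatures_principalCurvatures u x (h.pos x hx) (h.contDiffAt hΩ hx)

theorem IsCurvatureFunction.le_of_forall_le (hf : IsCurvatureFunction f) {κ : Fin n → ℝ} {c : ℝ}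
    (hc : 0 < c) (h : ∀ i, c ≤ κ i) : c ≤ f κ := by
  have := hf.mono (l := fun _ => c) (fun _ => hc) h
  rwa [hf.apply_const hc] at this

theorem IsCurvatureFunction.apply_le_of_forall_le (hf : IsCurvatureFunction f) {κ : Fin n → ℝ}
    {c : ℝ} (hκ : κ ∈ posCone n) (hc : 0 < c) (h : ∀ i, κ i ≤ c) : f κ ≤ c := by
  have := hf.mono hκ (m := fun _ => c) h
  rwa [hf.apply_const hc] at this

/-- Each graph point lies on a sphere centred at (a, -k) that meets height 0 along the boundary of
the ball, and larger k means a lower cap. A point violating the bound has k > ρm. The graph touches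
the cap of largest k from above, at an interior point because k > 0, so its curvature is at least
k/√(ρ² + k²), which then exceeds s. -/
theorem interior_barrier_closedBall (hf : IsCurvatureFunction f) (hΩ : IsOpen Ω)
    (h : IsStrictlyLocallyConvexGraph Ω u) {s m : ℝ} (hm : 0 < m)
    (hsm : s ^ 2 * (1 + m ^ 2) = m ^ 2) (hbd : ∀ x ∈ Ω, f (principalCurvatures u x) ≤ s)
    {a : E} {ρ : ℝ} (hρ : 0 < ρ) (hsub : Metric.closedBall a ρ ⊆ Ω) :
    ∀ x ∈ Metric.closedBall a ρ, ρ ^ 2 - ‖x - a‖ ^ 2 - u x ^ 2 ≤ 2 * ρ * m * u x := by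
  intro x hx
  by_contra! hcon
  have hcont : ContinuousOn u (Metric.closedBall a ρ) :=
    h.contDiffOn.continuousOn.mono hsub
  obtain ⟨y, hy, hmax⟩ := (isCompact_closedBall a ρ).exists_isMaxOn ⟨x, hx⟩
    (f := fun y => (ρ ^ 2 - ‖y - a‖ ^ 2 - u y ^ 2) / u y)
    (((continuousOn_const.sub (by fun_prop)).sub (hcont.pow 2)).div hcont
      fun y hy => (h.pos y (hsub hy)).ne')
  have huy := h.pos y (hsub hy)
  set k := (ρ ^ 2 - ‖y - a‖ ^ 2 - u y ^ 2) / (2 * u y) with hk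
  have hky : ρ ^ 2 - ‖y - a‖ ^ 2 - u y ^ 2 = 2 * k * u y := by
    rw [hk]
    field_simp
  have hmax' : ∀ w ∈ Metric.closedBall a ρ, ρ ^ 2 - ‖w - a‖ ^ 2 - u w ^ 2 ≤ 2 * k * u w :=
    fun w hw => by
    have h1 : (ρ ^ 2 - ‖w - a‖ ^ 2 - u w ^ 2) / u w ≤ (ρ ^ 2 - ‖y - a‖ ^ 2 - u y ^ 2) / u y :=
      hmax hw
    rw [hky, mul_div_cancel_right₀ _ huy.ne', div_le_iff₀ (h.pos w (hsub hw))] at h1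
    exact h1
  have hkm : ρ * m < k := by
    have h1 := hcon.trans_le (hmax' x hx)
    have := lt_of_mul_lt_mul_right h1 (h.pos x (hsub hx)).le
    linarith
  have hk0 : 0 < k := (mul_pos hρ hm).trans hkm
  have hball : y ∈ Metric.ball a ρ := by
    -- On the bounding sphere the numerator would be -u², whereas it equals 2ku > 0.
    rw [mem_ball_iff_norm]
    have : 0 < 2 * k * u y := by positivity
    nlinarith [sq_nonneg (u y), norm_nonneg (y - a)]
  have hr : 0 < Real.sqrt (ρ ^ 2 + k ^ 2) := by positivity
  have hr2 : Real.sqrt (ρ ^ 2 + k ^ 2) ^ 2 = ρ ^ 2 + k ^ 2 := Real.sq_sqrt (by positivity)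
  have hκ := le_curvature_of_sphere_above (h.isPrincipalCurvatures hΩ (hsub hy)) huy
    (h.contDiffAt hΩ (hsub hy)) (c := a) (h := -k) hr (by
      filter_upwards [Metric.isOpen_ball.mem_nhds hball] with w hw
      have := hmax' w (Metric.ball_subset_closedBall hw)
      rw [hr2]
      nlinarith) (by rw [hr2]; linarith) (by linarith)
  have h1 := (hf.le_of_forall_le (by simpa using div_pos hk0 hr) hκ).trans (hbd y (hsub hy))
  rw [neg_neg, div_le_iff₀ hr] at h1
  have h2 : k ^ 2 ≤ s ^ 2 * (ρ ^ 2 + k ^ 2) := by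
    rw [← hr2, ← mul_pow]
    exact pow_le_pow_left₀ hk0.le h1 2
  have h3 : (ρ * m) ^ 2 < k ^ 2 := pow_lt_pow_left₀ hkm (by positivity) two_ne_zero
  have h4 : k ^ 2 * (1 + m ^ 2) ≤ m ^ 2 * (ρ ^ 2 + k ^ 2) := by
    rw [← hsm]
    nlinarith [sq_nonneg m]
  nlinarith

/-- A graph over `Ω` whose curvature is at most `s` lies above the equidistant spheres of curvature
`s` over the balls in `Ω`. -/
theorem interior_barrier (hf : IsCurvatureFunction f) (hΩ : IsOpen Ω)
    (h : IsStrictlyLocallyConvexGraph Ω u) {s m : ℝ} (hm : 0 < m)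
    (hsm : s ^ 2 * (1 + m ^ 2) = m ^ 2) (hbd : ∀ x ∈ Ω, f (principalCurvatures u x) ≤ s)
    {a : E} {ρ : ℝ} (hsub : Metric.ball a ρ ⊆ Ω) :
    ∀ x ∈ Metric.ball a ρ, ρ ^ 2 - ‖x - a‖ ^ 2 - u x ^ 2 ≤ 2 * ρ * m * u x := by
  intro x hx
  rw [mem_ball_iff_norm] at hx
  have hc : ContinuousWithinAt (fun r : ℝ => 2 * r * m * u x - (r ^ 2 - ‖x - a‖ ^ 2 - u x ^ 2))
      (Set.Iio ρ) ρ := by fun_prop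
  refine sub_nonneg.1 (ge_of_tendsto hc ?_)
  filter_upwards [Ioo_mem_nhdsLT hx] with r hr
  refine sub_nonneg.2 (interior_barrier_closedBall hf hΩ h hm hsm hbd
    ((norm_nonneg _).trans_lt hr.1) ((Metric.closedBall_subset_ball hr.2).trans hsub) x ?_)
  rw [mem_closedBall_iff_norm]
  exact hr.1.le

/-- Spheres centred at (a, k) through the boundary of the ball at height 0 are enlarged until first
contact. Contact is sought with the whole region under the graph, the points (y, t u(y)) with 0 ≤ t
≤ 1: contact with the graph alone might occur on the upper cap, where the curvature comparison has
the wrong sign. A violation gives contact for some k < ρm, hence curvature below s. -/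
theorem exterior_barrier_of_lt (hf : IsCurvatureFunction f) (hΩ : IsOpen Ω)
    (hΩb : Bornology.IsBounded Ω)
    (h : IsStrictlyLocallyConvexGraph Ω u) (h0 : ∀ x ∈ frontier Ω, u x = 0)
    {s m : ℝ} (hs : 0 < s)
    (hsm : s ^ 2 * (1 + m ^ 2) = m ^ 2) (hbd : ∀ x ∈ Ω, s < f (principalCurvatures u x))
    {a : E} {ρ : ℝ} (hρ : 0 < ρ) (hsub : ∀ x ∈ closure Ω, ρ < ‖x - a‖) :
    ∀ x ∈ Ω, 2 * ρ * m * u x ≤ ‖x - a‖ ^ 2 + u x ^ 2 - ρ ^ 2 := by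
  intro x hx
  by_contra! hcon
  have hA : ∀ y ∈ closure Ω, 0 < ‖y - a‖ ^ 2 - ρ ^ 2 := fun y hy => by
    have := hsub y hy
    nlinarith
  have hclos : IsCompact (closure Ω) :=
    Metric.isCompact_of_isClosed_isBounded isClosed_closure hΩb.closure
  have hu : ContinuousOn (fun p : E × ℝ => p.2 * u p.1) (closure Ω ×ˢ Set.Icc (0 : ℝ) 1) :=
    continuousOn_snd.mul (h.continuousOn.comp continuousOn_fst fun p hp => hp.1)
  obtain ⟨⟨y, t⟩, ⟨hy, ht⟩, hmax⟩ := (hclos.prod (isCompact_Icc (a := (0 : ℝ)) (b := 1))).exists_isMaxOn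
    ⟨(x, 1), subset_closure hx, by simp⟩
    (f := fun p : E × ℝ => p.2 * u p.1 / (‖p.1 - a‖ ^ 2 - ρ ^ 2 + (p.2 * u p.1) ^ 2))
    (hu.div ((by fun_prop : ContinuousOn (fun p : E × ℝ => ‖p.1 - a‖ ^ 2 - ρ ^ 2) _).add
      (hu.pow 2)) fun p hp => (add_pos_of_pos_of_nonneg (hA _ hp.1) (sq_nonneg _)).ne')
  have hmax1 : ∀ w ∈ closure Ω, ∀ t' ∈ Set.Icc (0 : ℝ) 1,
      t' * u w / (‖w - a‖ ^ 2 - ρ ^ 2 + (t' * u w) ^ 2)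
        ≤ t * u y / (‖y - a‖ ^ 2 - ρ ^ 2 + (t * u y) ^ 2) := fun w hw t' ht' =>
    hmax (a := (w, t')) ⟨hw, ht'⟩
  have hden : ∀ w ∈ closure Ω, ∀ r : ℝ, 0 < ‖w - a‖ ^ 2 - ρ ^ 2 + r ^ 2 := fun w hw r =>
    add_pos_of_pos_of_nonneg (hA w hw) (sq_nonneg _)
  have hux := h.pos x hx
  have hV := hmax1 x (subset_closure hx) 1 (by simp)
  rw [one_mul] at hV
  have htu : 0 < t * u y := by
    have := (div_pos hux (hden x (subset_closure hx) (u x))).trans_le hV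
    exact (div_pos_iff_of_pos_right (hden y hy _)).1 this
  have ht0 : 0 < t := lt_of_le_of_ne ht.1 fun h => by simp [← h] at htu
  have huy : 0 < u y := pos_of_mul_pos_right htu ht.1
  have hyΩ : y ∈ Ω := by
    by_contra hn
    have : y ∈ frontier Ω := by
      rw [hΩ.frontier_eq]
      exact ⟨hy, hn⟩
    exact huy.ne' (h0 y this)
  set k := (‖y - a‖ ^ 2 - ρ ^ 2 + (t * u y) ^ 2) / (2 * (t * u y)) with hk
  have hk0 : 0 < k := div_pos (hden y hy _) (by positivity)
  have hky : ‖y - a‖ ^ 2 - ρ ^ 2 + (t * u y) ^ 2 = 2 * k * (t * u y) := by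
    rw [hk]
    field_simp
  have hmax' : ∀ w ∈ closure Ω, ∀ t' ∈ Set.Icc (0 : ℝ) 1,
      2 * k * (t' * u w) ≤ ‖w - a‖ ^ 2 - ρ ^ 2 + (t' * u w) ^ 2 := fun w hw t' ht' => by
    have h1 := hmax1 w hw t' ht'
    rw [hky, div_le_div_iff₀ (hden w hw _) (by positivity)] at h1
    refine le_of_mul_le_mul_left (a := t * u y) ?_ htu
    linarith
  have hkm : k < ρ * m := by
    have h1 := hmax' x (subset_closure hx) 1 (by simp)
    rw [one_mul] at h1
    have h2 : 2 * k * u x < 2 * (ρ * m) * u x := by linarith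
    have := lt_of_mul_lt_mul_right h2 hux.le
    linarith
  -- A contact point strictly under the graph could be moved horizontally towards a, remaining under
  -- the graph and entering the sphere.
  have ht1 : t = 1 := by
    by_contra hne
    have ht1 : t < 1 := lt_of_le_of_ne ht.2 hne
    have hlt : t * u y < u y := by nlinarith
    have hcty : ContinuousAt u y := (h.contDiffAt hΩ hyΩ).continuousAt
    have hev := (tendsto_line y (a - y)).eventually
      ((hcty.eventually (lt_mem_nhds hlt)).and (hΩ.mem_nhds hyΩ))
    obtain ⟨δ, hδ, hball⟩ := Metric.eventually_nhds_iff.1 hev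
    set τ := min (δ / 2) 1 with hτ
    have hτ0 : 0 < τ := by positivity
    have hτ1 : τ ≤ 1 := min_le_right _ _
    have hτδ : τ < δ := (min_le_left _ _).trans_lt (by linarith)
    obtain ⟨h1, h2⟩ := hball (y := τ) (by rw [Real.dist_eq, sub_zero, abs_of_pos hτ0]; exact hτδ)
    have huw := htu.trans h1
    have h3 := hmax' _ (subset_closure h2) (t * u y / u (y + τ • (a - y)))
      ⟨by positivity, (div_le_one huw).2 h1.le⟩
    rw [div_mul_cancel₀ _ huw.ne', ← hky] at h3
    have h4 : y + τ • (a - y) - a = (1 - τ) • (y - a) := by module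
    rw [h4, norm_smul, Real.norm_eq_abs, mul_pow |1 - τ|, sq_abs] at h3
    have h5 : 0 < ‖y - a‖ ^ 2 := by nlinarith [hA y hy, sq_nonneg ρ]
    nlinarith [mul_pos hτ0 h5]
  rw [ht1, one_mul] at hky
  -- If the contact were above the centre, the point at height k on the same vertical would lie
  -- under the graph and strictly inside the sphere.
  have huk : u y ≤ k := by
    by_contra! hlt
    have h1 := hmax' y hy (k / u y) ⟨by positivity, (div_le_one huy).2 hlt.le⟩
    rw [div_mul_cancel₀ _ huy.ne'] at h1
    nlinarith
  have hr : 0 < Real.sqrt (ρ ^ 2 + k ^ 2) := by positivity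
  have hr2 : Real.sqrt (ρ ^ 2 + k ^ 2) ^ 2 = ρ ^ 2 + k ^ 2 := Real.sq_sqrt (by positivity)
  have hlm : IsLocalMax
      (fun w => Real.sqrt (ρ ^ 2 + k ^ 2) ^ 2 - ‖w - a‖ ^ 2 - (u w - k) ^ 2) y := by
    filter_upwards [hΩ.mem_nhds hyΩ] with w hw
    have := hmax' w (subset_closure hw) 1 (by simp)
    rw [one_mul] at this
    rw [hr2]
    nlinarith
  have h00 : Real.sqrt (ρ ^ 2 + k ^ 2) ^ 2 - ‖y - a‖ ^ 2 - (u y - k) ^ 2 = 0 := by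
    rw [hr2]
    linarith
  -- Contact at the equator would need a vertical tangent plane, impossible for a graph.
  have huk' : u y < k := lt_of_le_of_ne huk fun he => by
    have := (sphere_touching (h.contDiffAt hΩ hyΩ) hlm h00).2
    rw [he, sub_self, zero_mul, hr2] at this
    nlinarith [sq_nonneg k]
  have hκ := curvature_le_of_sphere_below (h.isPrincipalCurvatures hΩ hyΩ) huy
    (h.contDiffAt hΩ hyΩ) hr hlm h00 huk'
  have h1 := (hbd y hyΩ).trans_le
    (hf.apply_le_of_forall_le (h.convex y hyΩ) (div_pos hk0 hr) hκ)
  rw [lt_div_iff₀ hr] at h1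
  have h2 : s ^ 2 * (ρ ^ 2 + k ^ 2) < k ^ 2 := by
    rw [← hr2, ← mul_pow]
    exact pow_lt_pow_left₀ h1 (by positivity) two_ne_zero
  have h3 : k ^ 2 < (ρ * m) ^ 2 := pow_lt_pow_left₀ hkm hk0.le two_ne_zero
  have h4 : m ^ 2 * (ρ ^ 2 + k ^ 2) ≤ k ^ 2 * (1 + m ^ 2) := by
    rw [← hsm]
    nlinarith [sq_nonneg m]
  nlinarith

/-- A graph over `Ω` with zero boundary values whose curvature is more than `s` lies below the
equidistant spheres of curvature `s` around the balls outside `Ω`. -/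
theorem exterior_barrier (hf : IsCurvatureFunction f) (hΩ : IsOpen Ω)
    (hΩb : Bornology.IsBounded Ω)
    (h : IsStrictlyLocallyConvexGraph Ω u) (h0 : ∀ x ∈ frontier Ω, u x = 0)
    {s m : ℝ} (hs : 0 < s)
    (hsm : s ^ 2 * (1 + m ^ 2) = m ^ 2) (hbd : ∀ x ∈ Ω, s < f (principalCurvatures u x))
    {a : E} {ρ : ℝ} (hρ : 0 < ρ) (hdisj : Disjoint (Metric.ball a ρ) Ω) :
    ∀ x ∈ Ω, 2 * ρ * m * u x ≤ ‖x - a‖ ^ 2 + u x ^ 2 - ρ ^ 2 := by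
  intro x hx
  have hc : ContinuousWithinAt (fun r : ℝ => ‖x - a‖ ^ 2 + u x ^ 2 - r ^ 2 - 2 * r * m * u x)
      (Set.Iio ρ) ρ := by fun_prop
  refine sub_nonneg.1 (ge_of_tendsto hc ?_)
  filter_upwards [Ioo_mem_nhdsLT hρ] with r hr
  refine sub_nonneg.2 (exterior_barrier_of_lt hf hΩ hΩb h h0 hs hsm hbd hr.1 ?_ x hx)
  intro y hy
  have h1 := Set.disjoint_left.1 (hdisj.symm.closure_left Metric.isOpen_ball) hy
  rw [mem_ball_iff_norm, not_lt] at h1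
  exact hr.2.trans_le h1

end HyperbolicGraph

namespace HyperbolicGraph

/-! ### Touching balls at the boundary of a smooth domain -/

variable {n : ℕ}

local notation "E" => EuclideanSpace ℝ (Fin n)

variable {f : (Fin n → ℝ) → ℝ} {Ω : Set (EuclideanSpace ℝ (Fin n))}
  {u₁ u₂ : EuclideanSpace ℝ (Fin n) → ℝ}

/-- Near each point, a smooth function is approximated by its linearization up to a uniform
quadratic error. -/
theorem exists_quadratic_bound {φ : E → ℝ} (hφ : ContDiff ℝ ∞ φ) (p : E) :
    ∃ L : ℝ, 0 < L ∧ ∃ δ > 0, ∀ q ∈ Metric.ball p δ, ∀ y ∈ Metric.ball p δ,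
      |φ y - φ q - fderiv ℝ φ q (y - q)| ≤ L * ‖y - q‖ ^ 2 := by
  have h1 : ContDiffAt ℝ 1 (fderiv ℝ φ) p :=
    ((contDiff_infty.1 hφ 2).fderiv_right (m := 1) (by norm_num)).contDiffAt
  obtain ⟨K, t, ht, hK⟩ := h1.exists_lipschitzOnWith
  obtain ⟨δ, hδ, hball⟩ := Metric.mem_nhds_iff.1 ht
  refine ⟨K + 1, by positivity, δ, hδ, fun q hq y hy => ?_⟩
  have hseg : segment ℝ q y ⊆ Metric.ball p δ := (convex_ball p δ).segment_subset hq hy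
  have h2 := (convex_segment q y).norm_image_sub_le_of_norm_fderiv_le' (f := φ)
    (φ := fderiv ℝ φ q) (C := K * ‖y - q‖)
    (fun w _ => hφ.differentiable (by simp) w) (fun w hw => ?_) (left_mem_segment ℝ q y)
    (right_mem_segment ℝ q y)
  · rw [Real.norm_eq_abs] at h2
    nlinarith [sq_nonneg ‖y - q‖]
  · rw [← dist_eq_norm]
    refine (hK.dist_le_mul w (hball (hseg hw)) q (hball hq)).trans ?_
    gcongr
    rw [dist_eq_norm]
    obtain ⟨θ, hθ, rfl⟩ := (segment_eq_image' ℝ q y ▸ hw)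
    rw [add_sub_cancel_left, norm_smul, Real.norm_eq_abs, abs_of_nonneg hθ.1]
    exact mul_le_of_le_one_left (norm_nonneg _) hθ.2

/-- Interior and exterior tangent balls of one radius serve all boundary points near p. In a ball of
radius ρ tangent at q, the normal component of y - q exceeds |y - q|²/(2ρ) in absolute value, so for
small ρ the linear term of φ beats the quadratic error and fixes its sign. -/
theorem exists_touching_balls (hΩ : IsBoundedSmoothDomain Ω) {p : E} (hp : p ∈ frontier Ω) :
    ∃ ρ > 0, ∃ δ > 0, ∀ q ∈ frontier Ω, dist q p < δ → ∃ ν : E, ‖ν‖ = 1 ∧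
      Metric.ball (q - ρ • ν) ρ ⊆ Ω ∧ Disjoint (Metric.ball (q + ρ • ν) ρ) Ω := by
  obtain ⟨φ, hφ, -, hdφ, hloc⟩ := hΩ.smooth_boundary p hp
  obtain ⟨L, hL, δ₁, hδ₁, hquad⟩ := exists_quadratic_bound hφ p
  obtain ⟨δ₂, hδ₂, hloc⟩ := Metric.eventually_nhds_iff.1 hloc
  have hcontg : Continuous fun y => ‖∇ φ y‖ := by
    have : Continuous (fderiv ℝ φ) := hφ.continuous_fderiv (by simp)
    exact ((InnerProductSpace.toDual ℝ E).symm.continuous.comp this).norm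
  have hgp : 0 < ‖∇ φ p‖ := by
    rw [norm_pos_iff]
    intro h
    exact hdφ ((InnerProductSpace.toDual ℝ E).symm.map_eq_zero_iff.1 h)
  set μ := ‖∇ φ p‖ / 2 with hμ
  have hμ0 : 0 < μ := by positivity
  obtain ⟨δ₃, hδ₃, hgrad⟩ := Metric.eventually_nhds_iff.1
    (hcontg.continuousAt.eventually (lt_mem_nhds (half_lt_self hgp)))
  set δ := min δ₁ (min δ₂ δ₃) with hδ
  have hδ0 : 0 < δ := by positivity
  have hδ1 : δ ≤ δ₁ := min_le_left _ _
  have hδ2 : δ ≤ δ₂ := (min_le_right _ _).trans (min_le_left _ _)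
  have hδ3 : δ ≤ δ₃ := (min_le_right _ _).trans (min_le_right _ _)
  -- The first bound keeps both balls where the local description holds; the second makes the linear
  -- term win.
  set ρ := min (δ / 4) (μ / (2 * L)) with hρ
  have hρ0 : 0 < ρ := by positivity
  have hρ1 : ρ ≤ δ / 4 := min_le_left _ _
  have hρ2 : 2 * L * ρ ≤ μ := by
    have : ρ ≤ μ / (2 * L) := min_le_right _ _
    rw [le_div_iff₀ (by positivity)] at this
    linarith
  refine ⟨ρ, hρ0, δ / 2, by positivity, fun q hq hqp => ?_⟩
  have hφq : φ q = 0 := by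
    refine le_antisymm ?_ ?_
    · have := mem_closure_iff_nhdsWithin_neBot.1 (frontier_subset_closure hq)
      refine le_of_tendsto (hφ.continuous.continuousWithinAt (s := Ω) (x := q)) ?_
      filter_upwards [self_mem_nhdsWithin, mem_nhdsWithin_of_mem_nhds
        (Metric.ball_mem_nhds q (by positivity : 0 < δ / 2))] with y hy hy'
      have : dist y p < δ₂ := by
        have := dist_triangle y q p
        rw [Metric.mem_ball] at hy'
        linarith
      exact ((hloc this).1 hy).le
    · by_contra! hlt
      have : q ∈ Ω := (hloc (by linarith)).2 hlt
      rw [hΩ.isOpen.frontier_eq] at hq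
      exact hq.2 this
  have hgq : μ < ‖∇ φ q‖ := hgrad (by linarith)
  have hgq0 : 0 < ‖∇ φ q‖ := hμ0.trans hgq
  set ν := ‖∇ φ q‖⁻¹ • ∇ φ q with hν
  have hν1 : ‖ν‖ = 1 := by
    rw [hν, norm_smul, norm_inv, norm_norm, inv_mul_cancel₀ hgq0.ne']
  have hdν : ∀ h : E, fderiv ℝ φ q h = ‖∇ φ q‖ * ⟪ν, h⟫_ℝ := fun h => by
    rw [hν, inner_smul_left, inner_gradient, RCLike.conj_to_real,
      mul_inv_cancel_left₀ hgq0.ne']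
  have hmem : ∀ y, ‖y - q‖ < 2 * ρ → dist y p < δ := fun y hy => by
    have := dist_triangle y q p
    rw [← dist_eq_norm] at hy
    linarith
  -- The sign σ treats both balls at once: -1 is the interior ball, 1 the exterior one.
  have key : ∀ y (σ : ℝ), σ ^ 2 = 1 → ‖y - (q + (σ * ρ) • ν)‖ < ρ →
      ‖y - q‖ < 2 * ρ ∧ L * ‖y - q‖ ^ 2 < σ * fderiv ℝ φ q (y - q) := by
    intro y σ hσ hy
    have e1 : y - (q + (σ * ρ) • ν) = (y - q) - (σ * ρ) • ν := by module
    have h1 : ‖y - (q + (σ * ρ) • ν)‖ ^ 2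
        = ‖y - q‖ ^ 2 - 2 * σ * ρ * ⟪ν, y - q⟫_ℝ + ρ ^ 2 := by
      rw [e1, norm_sub_sq_real, inner_smul_right, norm_smul, hν1, mul_one, Real.norm_eq_abs,
        sq_abs, real_inner_comm, mul_pow, hσ]
      ring
    have h2 : ‖y - q‖ ^ 2 < 2 * ρ * (σ * ⟪ν, y - q⟫_ℝ) := by
      have := pow_lt_pow_left₀ hy (norm_nonneg _) two_ne_zero
      linarith
    have h3 : 0 < σ * ⟪ν, y - q⟫_ℝ := by
      by_contra! hle
      nlinarith [sq_nonneg ‖y - q‖]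
    refine ⟨?_, ?_⟩
    · have e2 : y - q = (y - (q + (σ * ρ) • ν)) + (σ * ρ) • ν := by module
      have h4 : ‖(σ * ρ) • ν‖ = ρ := by
        rw [norm_smul, hν1, mul_one, Real.norm_eq_abs, abs_mul, abs_of_pos hρ0,
          show |σ| = 1 by simpa using (sq_eq_sq_iff_abs_eq_abs σ 1).1 (by simpa using hσ), one_mul]
      rw [e2]
      linarith [norm_add_le (y - (q + (σ * ρ) • ν)) ((σ * ρ) • ν)]
    · rw [hdν]
      have h5 : μ * (σ * ⟪ν, y - q⟫_ℝ) < ‖∇ φ q‖ * (σ * ⟪ν, y - q⟫_ℝ) :=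
        mul_lt_mul_of_pos_right hgq h3
      nlinarith [mul_le_mul_of_nonneg_right hρ2 h3.le]
  have hq1 : q ∈ Metric.ball p δ₁ := by
    rw [Metric.mem_ball]
    linarith
  refine ⟨ν, hν1, fun y hy => ?_, Set.disjoint_left.2 fun y hy hyΩ => ?_⟩
  · rw [mem_ball_iff_norm] at hy
    obtain ⟨h1, h2⟩ := key y (-1) (by norm_num) (by
      rwa [neg_one_mul, neg_smul, ← sub_eq_add_neg])
    have h3 := hquad q hq1 y ((hmem y h1).trans_le hδ1)
    rw [hφq] at h3
    refine (hloc ((hmem y h1).trans_le hδ2)).2 ?_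
    linarith [(abs_le.1 h3).2]
  · rw [mem_ball_iff_norm] at hy
    obtain ⟨h1, h2⟩ := key y 1 (by norm_num) (by rwa [one_mul])
    have h3 := hquad q hq1 y ((hmem y h1).trans_le hδ1)
    rw [hφq] at h3
    have := (hloc ((hmem y h1).trans_le hδ2)).1 hyΩ
    linarith [(abs_le.1 h3).1]

/-- Near the asymptotic boundary, the lower graph is almost above the upper one. -/
theorem eventually_lt_mul_of_zero_boundary (hf : IsCurvatureFunction f)
    (hΩ : IsBoundedSmoothDomain Ω) (h₁ : IsStrictlyLocallyConvexGraph Ω u₁)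
    (h₂ : IsStrictlyLocallyConvexGraph Ω u₂)
    (hb₁ : ∀ x ∈ frontier Ω, u₁ x = 0) (hb₂ : ∀ x ∈ frontier Ω, u₂ x = 0)
    {s m : ℝ} (hs : 0 < s) (hm : 0 < m) (hsm : s ^ 2 * (1 + m ^ 2) = m ^ 2)
    (hc₁ : ∀ x ∈ Ω, f (principalCurvatures u₁ x) ≤ s)
    (hc₂ : ∀ x ∈ Ω, s < f (principalCurvatures u₂ x))
    {p : E} (hp : p ∈ frontier Ω) {η : ℝ} (hη : 0 < η) :
    ∀ᶠ x in 𝓝[Ω] p, u₂ x < (1 + η) * u₁ x := by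
  obtain ⟨ρ, hρ, δ, hδ, hballs⟩ := exists_touching_balls hΩ hp
  have hpc : p ∈ closure Ω := frontier_subset_closure hp
  have hlim : ∀ u : E → ℝ, IsStrictlyLocallyConvexGraph Ω u → (∀ x ∈ frontier Ω, u x = 0) →
      Filter.Tendsto u (𝓝[Ω] p) (𝓝 0) := fun u hu hb => by
    rw [← hb p hp]
    exact (hu.continuousOn p hpc).mono subset_closure
  -- The two barriers will compare `u₁` and `u₂` up to the factor (2ρm + r)(2ρ + r)/((2ρm - r)(2ρ -
  -- r)), which tends to 1.
  have hsmall : ∀ᶠ r : ℝ in 𝓝 0,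
      (2 * ρ * m + r) * (2 * ρ + r) < (1 + η) * ((2 * ρ * m - r) * (2 * ρ - r)) ∧
        r < 2 * ρ * m ∧ r < ρ := by
    refine Filter.Eventually.and ?_ ((gt_mem_nhds (by positivity)).and (gt_mem_nhds hρ))
    have hc : ContinuousAt (fun r : ℝ => (1 + η) * ((2 * ρ * m - r) * (2 * ρ - r))
        - (2 * ρ * m + r) * (2 * ρ + r)) 0 := by fun_prop
    have h0 : 0 < (1 + η) * ((2 * ρ * m - 0) * (2 * ρ - 0))
        - (2 * ρ * m + 0) * (2 * ρ + 0) := by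
      have : 0 < η * (2 * ρ * m * (2 * ρ)) := by positivity
      linarith
    exact (hc.eventually (lt_mem_nhds h0)).mono fun r hr => sub_pos.1 hr
  obtain ⟨r₀, hr₀, hr⟩ := Metric.eventually_nhds_iff.1 hsmall
  set r := r₀ / 2 with hrdef
  have hr0 : 0 < r := by positivity
  obtain ⟨hr1, hr2, hr3⟩ := hr (y := r) (by
    rw [Real.dist_eq, sub_zero, abs_of_pos hr0]
    linarith)
  filter_upwards [self_mem_nhdsWithin, (hlim u₁ h₁ hb₁).eventually (gt_mem_nhds hr0),
    (hlim u₂ h₂ hb₂).eventually (gt_mem_nhds hr0),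
    mem_nhdsWithin_of_mem_nhds (Metric.ball_mem_nhds p (by positivity : 0 < min r (δ / 2)))]
    with x hx hx1 hx2 hxp
  rw [Metric.mem_ball, lt_min_iff] at hxp
  have hpn : p ∈ Ωᶜ := by
    rw [hΩ.isOpen.frontier_eq] at hp
    exact hp.2
  obtain ⟨q, hq, hdq⟩ := hΩ.isOpen.isClosed_compl.exists_infDist_eq_dist ⟨p, hpn⟩ x
  set d := dist x q with hd
  have hdp : d ≤ dist x p := hdq ▸ Metric.infDist_le_dist_of_mem hpn
  have hsub : Metric.ball x d ⊆ Ω := by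
    rw [← hdq]
    intro y hy
    by_contra hn
    have := Metric.infDist_le_dist_of_mem (x := x) (show y ∈ Ωᶜ from hn)
    rw [Metric.mem_ball, dist_comm] at hy
    linarith
  have hd0 : 0 < d := by
    refine dist_pos.2 fun h => hq (h ▸ hx)
  have hqf : q ∈ frontier Ω := by
    rw [hΩ.isOpen.frontier_eq]
    refine ⟨closure_mono hsub ?_, hq⟩
    rw [closure_ball x hd0.ne', Metric.mem_closedBall, dist_comm]
  obtain ⟨ν, hν, hin, hout⟩ := hballs q hqf (by
    have := dist_triangle q x p
    rw [dist_comm q x] at this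
    linarith [hxp.2])
  -- The ball about x lies in Ω and misses the exterior ball at q, so the centres are at least d + ρ
  -- apart. With |x - q| = d this forces x = q - dν, and both barriers are evaluated on the same
  -- normal line.
  have hinner : ⟪ν, x - q⟫_ℝ ≤ -d := by
    have h1 := (disjoint_ball_ball_iff hd0 hρ).1 (hout.symm.mono_left hsub)
    rw [dist_eq_norm, show x - (q + ρ • ν) = (x - q) - ρ • ν by module] at h1
    have h2 := pow_le_pow_left₀ (by positivity) h1 2
    rw [norm_sub_sq_real, inner_smul_right, norm_smul, hν, mul_one, Real.norm_eq_abs, sq_abs,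
      real_inner_comm, ← dist_eq_norm, ← hd] at h2
    nlinarith
  have hinner' : -d ≤ ⟪ν, x - q⟫_ℝ := by
    have := (abs_le.1 (abs_real_inner_le_norm ν (x - q))).1
    rwa [hν, one_mul, ← dist_eq_norm] at this
  have heq : ⟪ν, x - q⟫_ℝ = -d := le_antisymm hinner hinner'
  have hnorm : ∀ σ : ℝ, ‖x - (q + σ • ν)‖ ^ 2 = d ^ 2 + 2 * σ * d + σ ^ 2 := fun σ => by
    rw [show x - (q + σ • ν) = (x - q) - σ • ν by module, norm_sub_sq_real, inner_smul_right,
      norm_smul, hν, mul_one, Real.norm_eq_abs, sq_abs, real_inner_comm, heq, ← dist_eq_norm, ← hd]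
    ring
  have hin' : q - ρ • ν = q + (-ρ) • ν := by module
  have hdr : d < r := hdp.trans_lt hxp.1
  have b1 := interior_barrier hf hΩ.isOpen h₁ hm hsm hc₁ hin x (by
    rw [mem_ball_iff_norm, hin']
    refine lt_of_pow_lt_pow_left₀ 2 hρ.le ?_
    rw [hnorm]
    nlinarith)
  have b2 := exterior_barrier hf hΩ.isOpen hΩ.isBounded h₂ hb₂ hs hsm hc₂ hρ hout x hx
  rw [hin', hnorm] at b1
  rw [hnorm] at b2
  have hu1 := h₁.pos x hx
  have hu2 := h₂.pos x hx
  -- To leading order the barriers say u₁ ≥ d/m and u₂ ≤ d/m; r absorbs the quadratic terms.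
  have c1 : d * (2 * ρ - r) ≤ u₁ x * (2 * ρ * m + r) := by nlinarith
  have c2 : u₂ x * (2 * ρ * m - r) ≤ d * (2 * ρ + r) := by nlinarith
  have p1 : 0 < 2 * ρ - r := by linarith
  have p2 : 0 < 2 * ρ * m - r := by linarith
  have c3 : u₂ x * ((2 * ρ * m - r) * (2 * ρ - r))
      ≤ u₁ x * ((2 * ρ * m + r) * (2 * ρ + r)) := by
    calc u₂ x * ((2 * ρ * m - r) * (2 * ρ - r))
        = u₂ x * (2 * ρ * m - r) * (2 * ρ - r) := by ring
      _ ≤ d * (2 * ρ + r) * (2 * ρ - r) := mul_le_mul_of_nonneg_right c2 p1.le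
      _ = d * (2 * ρ - r) * (2 * ρ + r) := by ring
      _ ≤ u₁ x * (2 * ρ * m + r) * (2 * ρ + r) :=
        mul_le_mul_of_nonneg_right c1 (by positivity)
      _ = _ := by ring
  have c4 := mul_lt_mul_of_pos_left hr1 hu1
  refine lt_of_mul_lt_mul_right (a := (2 * ρ * m - r) * (2 * ρ - r)) ?_ (by positivity)
  linarith

end HyperbolicGraph

namespace HyperbolicGraph

/-! ### Convexity of the region above a strictly locally convex graph -/

variable {n : ℕ}

local notation "E" => EuclideanSpace ℝ (Fin n)

variable {f : (Fin n → ℝ) → ℝ} {Ω : Set (EuclideanSpace ℝ (Fin n))}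
  {u u₁ u₂ : EuclideanSpace ℝ (Fin n) → ℝ} {x z : EuclideanSpace ℝ (Fin n)}

/-- The tangent hyperplane at z is the hemisphere centred at c = z + u∇u of radius uw. Along the
segment, u² + |· - c|² is convex and has zero derivative at z, so it never falls below its initial
value (uw)². -/
theorem tangent_hyperplane_le_of_segment (hΩ : IsOpen Ω) (h : IsStrictlyLocallyConvexGraph Ω u)
    {v : E} {T : ℝ} (hT : 0 ≤ T) (hseg : ∀ t ∈ Set.Icc 0 T, z + t • v ∈ Ω) :
    (u z * slopeFactor u z) ^ 2 ≤
      u (z + T • v) ^ 2 + ‖z + T • v - (z + u z • ∇ u z)‖ ^ 2 := by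
  set c := z + u z • ∇ u z with hc
  have hd : ∀ t ∈ Set.Icc 0 T, HasDerivAt (fun t : ℝ => u (z + t • v))
      (fderiv ℝ u (z + t • v) v) t := fun t ht =>
    (((h.contDiffAt hΩ (hseg t ht)).differentiableAt (by simp)).hasFDerivAt).comp_hasDerivAt t
      (hasDerivAt_line z v t)
  have hd' : ∀ t ∈ Set.Icc 0 T, HasDerivAt (fun t : ℝ => fderiv ℝ u (z + t • v) v)
      (fderiv ℝ (fderiv ℝ u) (z + t • v) v v) t := fun t ht => by
    have h1 := (differentiableAt_fderiv (h.contDiffAt hΩ (hseg t ht))).hasFDerivAt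
    have h2 := h1.comp_hasDerivAt t (hasDerivAt_line z v t)
    exact h2.clm_apply (hasDerivAt_const t v) |>.congr_deriv (by simp)
  have hl : ∀ t, HasDerivAt (fun t : ℝ => z + t • v - c) v t := fun t =>
    (hasDerivAt_line z v t).sub_const c
  have hG : ∀ t ∈ Set.Icc 0 T,
      HasDerivAt (fun t : ℝ => u (z + t • v) ^ 2 + ‖z + t • v - c‖ ^ 2)
        (2 * (u (z + t • v) * fderiv ℝ u (z + t • v) v + ⟪z + t • v - c, v⟫_ℝ)) t := fun t ht => by
    refine (((hd t ht).pow 2).add (hl t).norm_sq).congr_deriv ?_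
    simp
    ring
  have hG' : ∀ t ∈ Set.Icc 0 T,
      HasDerivAt (fun t : ℝ => 2 * (u (z + t • v) * fderiv ℝ u (z + t • v) v
        + ⟪z + t • v - c, v⟫_ℝ)) (2 * ⟪convexVec u (z + t • v) v, v⟫_ℝ) t := fun t ht => by
    refine ((((hd t ht).mul (hd' t ht)).add
      ((hl t).inner ℝ (hasDerivAt_const t v))).const_mul 2).congr_deriv ?_
    simp only [convexVec, inner_add_left, inner_smul_left, inner_hessVec, inner_gradient,
      inner_zero_right, RCLike.conj_to_real]
    ring
  have hmono' : MonotoneOn (fun t : ℝ => 2 * (u (z + t • v) * fderiv ℝ u (z + t • v) v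
      + ⟪z + t • v - c, v⟫_ℝ)) (Set.Icc 0 T) := by
    refine monotoneOn_of_deriv_nonneg (convex_Icc 0 T)
      (fun t ht => (hG' t ht).continuousAt.continuousWithinAt)
      (fun t ht => (hG' t (interior_subset ht)).differentiableAt.differentiableWithinAt)
      fun t ht => ?_
    have ht' := interior_subset ht
    rw [(hG' t ht').deriv]
    rcases eq_or_ne v 0 with rfl | hv
    · simp
    · have hy := hseg t ht'
      have := inner_convexVec_pos (h.isPrincipalCurvatures hΩ hy) (h.pos _ hy) (h.convex _ hy) v hv
      linarith
  have hmono : MonotoneOn (fun t : ℝ => u (z + t • v) ^ 2 + ‖z + t • v - c‖ ^ 2)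
      (Set.Icc 0 T) := by
    refine monotoneOn_of_deriv_nonneg (convex_Icc 0 T)
      (fun t ht => (hG t ht).continuousAt.continuousWithinAt)
      (fun t ht => (hG t (interior_subset ht)).differentiableAt.differentiableWithinAt)
      fun t ht => ?_
    have ht' := interior_subset ht
    rw [(hG t ht').deriv]
    refine le_trans ?_ (hmono' (Set.left_mem_Icc.2 hT) ht' ht'.1)
    simp [hc, inner_smul_left]
  have := hmono (Set.left_mem_Icc.2 hT) (Set.right_mem_Icc.2 hT) hT
  refine le_trans (le_of_eq ?_) this
  simp only [zero_smul, add_zero, hc, sub_add_cancel_left, norm_neg, norm_smul, mul_pow,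
    slopeFactor_sq, Real.norm_eq_abs, sq_abs]
  ring

/-- Above the boundary height, the half-ball below a tangent totally geodesic hyperplane lies below
the graph. -/
theorem tangent_hyperplane_le (hΩ : IsOpen Ω) (h : IsStrictlyLocallyConvexGraph Ω u) {ε : ℝ}
    (hε : 0 ≤ ε) (hb : ∀ x ∈ frontier Ω, u x = ε) (hz : z ∈ Ω) (hzε : ε < u z)
    (hx : ‖x - (z + u z • ∇ u z)‖ ^ 2 + ε ^ 2 < (u z * slopeFactor u z) ^ 2) :
    x ∈ Ω ∧ (u z * slopeFactor u z) ^ 2 ≤ u x ^ 2 + ‖x - (z + u z • ∇ u z)‖ ^ 2 := by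
  have hx1 : z + (1 : ℝ) • (x - z) = x := by module
  by_cases hall : ∀ t ∈ Set.Icc (0 : ℝ) 1, z + t • (x - z) ∈ Ω
  · have h1 := tangent_hyperplane_le_of_segment hΩ h zero_le_one hall
    have h2 := hall 1 (by simp)
    rw [hx1] at h1 h2
    exact ⟨h2, h1⟩
  exfalso
  push Not at hall
  have hcont : Continuous fun t : ℝ => z + t • (x - z) := by fun_prop
  -- Consider the first exit T of the segment from Ω. There u = ε, so the exit point is at distance
  -- at least √(r² - ε²) from c, with r = u(z)w(z). But z and x both lie in the open ball of that
  -- radius, which is convex.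
  have hcpt : IsCompact (Set.Icc (0 : ℝ) 1 ∩ {t | z + t • (x - z) ∉ Ω}) :=
    isCompact_Icc.inter_right (hΩ.isClosed_compl.preimage hcont)
  obtain ⟨T, ⟨⟨hT0, hT1⟩, hTn⟩, hTleast⟩ := hcpt.exists_isLeast hall
  have hTn : z + T • (x - z) ∉ Ω := hTn
  have hTpos : 0 < T := lt_of_le_of_ne hT0 fun h0 => hTn (by simpa [← h0] using hz)
  have hin : ∀ t ∈ Set.Ico 0 T, z + t • (x - z) ∈ Ω := fun t ht => by
    by_contra hn
    exact absurd (hTleast ⟨⟨ht.1, (ht.2.trans_le hT1).le⟩, hn⟩) (not_le.2 ht.2)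
  have hIio : Set.Ico 0 T ∈ 𝓝[<] T := Ico_mem_nhdsLT hTpos
  have htend : Filter.Tendsto (fun t : ℝ => z + t • (x - z)) (𝓝[<] T)
      (𝓝[closure Ω] (z + T • (x - z))) := by
    refine tendsto_nhdsWithin_iff.2 ⟨hcont.continuousWithinAt, ?_⟩
    filter_upwards [hIio] with t ht using subset_closure (hin t ht)
  have hcl : z + T • (x - z) ∈ closure Ω := by
    refine mem_closure_of_tendsto (hcont.continuousWithinAt (s := Set.Iio T)) ?_
    filter_upwards [hIio] with t ht using hin t ht
  have hfr : z + T • (x - z) ∈ frontier Ω := by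
    rw [hΩ.frontier_eq]
    exact ⟨hcl, hTn⟩
  have hlim : (u z * slopeFactor u z) ^ 2 ≤
      u (z + T • (x - z)) ^ 2 + ‖z + T • (x - z) - (z + u z • ∇ u z)‖ ^ 2 := by
    have hu : Filter.Tendsto (fun t : ℝ => u (z + t • (x - z))) (𝓝[<] T)
        (𝓝 (u (z + T • (x - z)))) := (h.continuousOn _ hcl).tendsto.comp htend
    have hn : Filter.Tendsto (fun t : ℝ => ‖z + t • (x - z) - (z + u z • ∇ u z)‖ ^ 2) (𝓝[<] T)
        (𝓝 (‖z + T • (x - z) - (z + u z • ∇ u z)‖ ^ 2)) :=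
      Continuous.continuousWithinAt (by fun_prop)
    refine ge_of_tendsto ((hu.pow 2).add hn) ?_
    filter_upwards [hIio] with t ht
    exact tangent_hyperplane_le_of_segment hΩ h ht.1 fun s hs =>
      hin s ⟨hs.1, hs.2.trans_lt ht.2⟩
  rw [hb _ hfr] at hlim
  set c := z + u z • ∇ u z with hc
  have hR : 0 ≤ (u z * slopeFactor u z) ^ 2 - ε ^ 2 := by nlinarith [sq_nonneg ‖x - c‖]
  set R := Real.sqrt ((u z * slopeFactor u z) ^ 2 - ε ^ 2) with hRdef
  have hR2 : R ^ 2 = (u z * slopeFactor u z) ^ 2 - ε ^ 2 := Real.sq_sqrt hR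
  have hxb : x ∈ Metric.ball c R := by
    rw [mem_ball_iff_norm]
    refine lt_of_pow_lt_pow_left₀ 2 (Real.sqrt_nonneg _) ?_
    rw [hR2]
    linarith
  have hzb : z ∈ Metric.ball c R := by
    rw [mem_ball_iff_norm]
    refine lt_of_pow_lt_pow_left₀ 2 (Real.sqrt_nonneg _) ?_
    rw [hR2, hc, sub_add_cancel_left, norm_neg, norm_smul, mul_pow, mul_pow, slopeFactor_sq,
      Real.norm_eq_abs, sq_abs]
    nlinarith
  have hmem := (convex_ball c R).add_smul_sub_mem hzb hxb ⟨hT0, hT1⟩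
  rw [mem_ball_iff_norm] at hmem
  have := pow_lt_pow_left₀ hmem (norm_nonneg _) two_ne_zero
  rw [hR2] at this
  linarith

/-! ### Hyperbolic distance to the upper region. -/

/-- The points of height at least `ε` that do not lie below the graph of `u` over `Ω`. -/
def upperRegion (ε : ℝ) (Ω : Set E) (u : E → ℝ) : Set (E × ℝ) :=
  {q | ε ≤ q.2 ∧ (q.1 ∈ Ω → u q.1 ≤ q.2)}

/-- The hyperbolic cosine of the distance from the point at height `y` above `x` to the upper region
is at least `C`. -/
def IsDistBound (ε : ℝ) (Ω : Set E) (u : E → ℝ) (x : E) (y C : ℝ) : Prop :=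
  ∀ q ∈ upperRegion ε Ω u, 2 * C * y * q.2 ≤ ‖x - q.1‖ ^ 2 + y ^ 2 + q.2 ^ 2

theorem isClosed_upperRegion (hΩ : IsOpen Ω) (hu : ContinuousOn u Ω) (ε : ℝ) :
    IsClosed (upperRegion ε Ω u) := by
  have h1 : IsOpen {q : E × ℝ | q.1 ∈ Ω ∧ q.2 < u q.1} := by
    have hs : IsOpen (Prod.fst ⁻¹' Ω : Set (E × ℝ)) := hΩ.preimage continuous_fst
    have hc : ContinuousOn (fun q : E × ℝ => u q.1 - q.2) (Prod.fst ⁻¹' Ω) :=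
      (hu.comp continuousOn_fst fun q hq => hq).sub continuousOn_snd
    convert hc.isOpen_inter_preimage hs (t := Set.Ioi 0) isOpen_Ioi using 1
    ext q
    simp
  have h2 : upperRegion ε Ω u
      = {q : E × ℝ | ε ≤ q.2} ∩ {q : E × ℝ | q.1 ∈ Ω ∧ q.2 < u q.1}ᶜ := by
    ext q
    simp [upperRegion]
  rw [h2]
  exact (isClosed_le continuous_const continuous_snd).inter h1.isClosed_compl

/-- The distance from a point to the complement of a half-space is at least its depth. -/
theorem le_dist_of_depth {c x x' : E} {r y y' A D : ℝ} (hr : 0 < r)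
    (hA : A = r ^ 2 - ‖x - c‖ ^ 2 - y ^ 2) (hA0 : 0 ≤ A)
    (hD2 : (2 * r * y * D) ^ 2 = (2 * r * y) ^ 2 + A ^ 2)
    (hq : r ^ 2 ≤ ‖x' - c‖ ^ 2 + y' ^ 2) :
    2 * D * y * y' ≤ ‖x - x'‖ ^ 2 + y ^ 2 + y' ^ 2 := by
  set X := ‖x - c‖ with hX
  set X' := ‖x' - c‖ with hX'
  have hX0 : 0 ≤ X := norm_nonneg _
  have hX0' : 0 ≤ X' := norm_nonneg _
  have htri : (X - X') ^ 2 ≤ ‖x - x'‖ ^ 2 := by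
    have := abs_norm_sub_norm_le (x - c) (x' - c)
    rw [sub_sub_sub_cancel_right] at this
    rw [← sq_abs (X - X')]
    exact pow_le_pow_left₀ (abs_nonneg _) this 2
  set α := X ^ 2 + y ^ 2 + r ^ 2 with hα
  set α' := X' ^ 2 + y' ^ 2 + r ^ 2 with hα'
  have e1 : (2 * r * y * D) ^ 2 = α ^ 2 - (2 * r * X) ^ 2 := by
    rw [hD2, hA]
    ring
  have e2 : (2 * r * y') ^ 2 ≤ α' ^ 2 - (2 * r * X') ^ 2 := by
    nlinarith [sq_nonneg (X' ^ 2 + y' ^ 2 - r ^ 2)]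
  have e3 : 0 ≤ α * α' - (2 * r * X) * (2 * r * X') := by
    refine sub_nonneg.2 (mul_le_mul ?_ ?_ (by positivity) (by positivity)) <;>
      nlinarith [sq_nonneg (X - r), sq_nonneg (X' - r), sq_nonneg y, sq_nonneg y']
  -- Reversed Cauchy–Schwarz inequality for the Lorentzian form α² - p².
  have e4 : (2 * r * y * D * (2 * r * y')) ^ 2 ≤ (α * α' - (2 * r * X) * (2 * r * X')) ^ 2 := by
    rw [mul_pow]
    calc (2 * r * y * D) ^ 2 * (2 * r * y') ^ 2
        ≤ (2 * r * y * D) ^ 2 * (α' ^ 2 - (2 * r * X') ^ 2) :=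
          mul_le_mul_of_nonneg_left e2 (sq_nonneg _)
      _ = (α ^ 2 - (2 * r * X) ^ 2) * (α' ^ 2 - (2 * r * X') ^ 2) := by rw [e1]
      _ ≤ _ := by nlinarith [sq_nonneg (α * (2 * r * X') - α' * (2 * r * X))]
  have e5 := (le_abs_self _).trans (abs_le_of_sq_le_sq e4 e3)
  have e6 : α * α' - (2 * r * X) * (2 * r * X')
      ≤ 2 * r ^ 2 * (X ^ 2 + y ^ 2 + (X' ^ 2 + y' ^ 2) - 2 * X * X') := by
    have : 0 ≤ A * (X' ^ 2 + y' ^ 2 - r ^ 2) := mul_nonneg hA0 (by linarith)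
    rw [hA] at this
    nlinarith
  have e7 : 2 * r ^ 2 * (2 * D * y * y')
      ≤ 2 * r ^ 2 * (X ^ 2 + y ^ 2 + (X' ^ 2 + y' ^ 2) - 2 * X * X') := by
    linarith
  have e8 := le_of_mul_le_mul_left e7 (by positivity)
  linarith

/-- If no point of the graph of `u₁` is farther from the upper region of `u₂` than `arcosh C`, then
none is deeper than that below a tangent hyperplane. -/
theorem eventually_depthExcess_nonpos (hΩ : IsOpen Ω) (h₁ : IsStrictlyLocallyConvexGraph Ω u₁)
    (h₂ : IsStrictlyLocallyConvexGraph Ω u₂) {ε : ℝ} (hε : 0 ≤ ε)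
    (hb : ∀ x ∈ frontier Ω, u₂ x = ε) {S C : ℝ} (hS : 0 ≤ S)
    (hCS : C ^ 2 = 1 + S ^ 2)
    (hmax : ∀ x ∈ Ω, ∀ C', IsDistBound ε Ω u₂ x (u₁ x) C' → C' ≤ C)
    (hx : x ∈ Ω) (hz : z ∈ Ω) (hzε : ε < u₂ z) :
    ∀ᶠ p : E × E in 𝓝 (x, z), depthExcess S u₁ u₂ p.1 p.2 ≤ 0 := by
  have hcz : ContinuousAt u₂ z := (h₂.contDiffAt hΩ hz).continuousAt
  filter_upwards [prod_mem_nhds (hΩ.mem_nhds hx)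
    (Filter.inter_mem (hΩ.mem_nhds hz) (hcz.eventually (lt_mem_nhds hzε)))]
    with ⟨x, z⟩ ⟨hx, hz, hzε⟩
  have hzε : ε < u₂ z := hzε
  have hx : x ∈ Ω := hx
  have hz : z ∈ Ω := hz
  change depthExcess S u₁ u₂ x z ≤ 0
  by_contra! hpos
  have hu1 := h₁.pos x hx
  have hu2 := h₂.pos z hz
  have hw := slopeFactor_pos u₂ z
  set r := u₂ z * slopeFactor u₂ z with hr
  have hr0 : 0 < r := by positivity
  set c := z + u₂ z • ∇ u₂ z with hc
  set A := r ^ 2 - ‖x - c‖ ^ 2 - u₁ x ^ 2 with hA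
  -- Completing the square exhibits the tangent hemisphere, of centre c and radius r; A/(2 r u₁) is
  -- the hyperbolic sine of the depth, and `D` below is its hyperbolic cosine.
  have hAe : depthExcess S u₁ u₂ x z = A - 2 * S * r * u₁ x := by
    have e1 : x - c = (x - z) - u₂ z • ∇ u₂ z := by
      rw [hc]
      abel
    rw [hA, e1, norm_sub_sq_real, inner_smul_right, norm_smul, Real.norm_eq_abs,
      mul_pow |u₂ z|, sq_abs, hr, mul_pow, slopeFactor_sq, depthExcess, real_inner_comm (x - z)]
    ring
  have hSA : 2 * S * r * u₁ x < A := by linarith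
  have hA0 : 0 ≤ A := le_trans (by positivity) hSA.le
  set D := Real.sqrt (1 + (A / (2 * r * u₁ x)) ^ 2) with hD
  have hD2 : D ^ 2 = 1 + (A / (2 * r * u₁ x)) ^ 2 := Real.sq_sqrt (by positivity)
  have hDC : C < D := by
    refine Real.lt_sqrt_of_sq_lt ?_
    rw [hCS]
    have : S < A / (2 * r * u₁ x) := by
      rw [lt_div_iff₀ (by positivity)]
      linarith
    have := pow_lt_pow_left₀ this hS two_ne_zero
    linarith
  refine absurd (hmax x hx D fun q hq => ?_) (not_le.2 hDC)
  refine le_dist_of_depth hr0 hA hA0 ?_ (c := c) ?_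
  · rw [mul_pow _ D, hD2]
    field_simp
  · by_contra! hlt
    have hq1 : ‖q.1 - c‖ ^ 2 + ε ^ 2 < r ^ 2 := by
      have := pow_le_pow_left₀ hε hq.1 2
      linarith
    obtain ⟨hqΩ, hle⟩ := tangent_hyperplane_le hΩ h₂ hε hb hz hzε hq1
    have h3 : q.2 ^ 2 < u₂ q.1 ^ 2 := by linarith
    have h4 := pow_le_pow_left₀ (h₂.pos _ hqΩ).le (hq.2 hqΩ) 2
    linarith

end HyperbolicGraph

namespace HyperbolicGraph

/-! ### The point of the lower graph that is farthest from the upper region -/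

variable {n : ℕ}

local notation "E" => EuclideanSpace ℝ (Fin n)

variable {f : (Fin n → ℝ) → ℝ} {Ω : Set (EuclideanSpace ℝ (Fin n))}
  {u u₁ u₂ : EuclideanSpace ℝ (Fin n) → ℝ} {x z : EuclideanSpace ℝ (Fin n)}

/-- The upper region is closed, so a neighbourhood of a point under the graph misses it; the rest
converts this Euclidean gap into a hyperbolic one. -/
theorem exists_isDistBound_gt_one (hΩ : IsOpen Ω) (hu : ContinuousOn u Ω) {ε : ℝ} (hε : 0 ≤ ε)
    {y : ℝ} (hy : 0 < y) (hx : x ∈ Ω) (hyu : y < u x) :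
    ∃ C > 1, IsDistBound ε Ω u x y C := by
  have hn : (x, y) ∈ (upperRegion ε Ω u)ᶜ := fun h => absurd (h.2 hx) (not_le.2 hyu)
  obtain ⟨δ, hδ, hball⟩ := Metric.isOpen_iff.1 (isClosed_upperRegion hΩ hu ε).isOpen_compl _ hn
  -- For heights up to 2y the bound through δ is used. Beyond 2y, k ≤ 1/4 gives 2ky q₂ ≤ (q₂ - y)².
  set k := min (1 / 4) (δ ^ 2 / (4 * y ^ 2)) with hk
  have hk0 : 0 < k := by positivity
  have hk1 : k ≤ 1 / 4 := min_le_left _ _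
  have hk2 : k * (4 * y ^ 2) ≤ δ ^ 2 := by
    rw [← le_div_iff₀ (by positivity)]
    exact min_le_right _ _
  refine ⟨1 + k, by linarith, fun q hq => ?_⟩
  have hq0 : 0 ≤ q.2 := hε.trans hq.1
  have hdist : δ ≤ dist q (x, y) := by
    by_contra! hlt
    exact hball hlt hq
  have hδq : δ ^ 2 ≤ ‖x - q.1‖ ^ 2 + (q.2 - y) ^ 2 := by
    rw [Prod.dist_eq, le_max_iff, dist_comm, dist_eq_norm, Real.dist_eq] at hdist
    rcases hdist with h | h
    · have := pow_le_pow_left₀ hδ.le h 2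
      nlinarith [sq_nonneg (q.2 - y)]
    · have := pow_le_pow_left₀ hδ.le h 2
      rw [sq_abs] at this
      nlinarith [sq_nonneg ‖x - q.1‖]
  rcases le_total q.2 (2 * y) with h | h
  · have h1 : 2 * k * y * q.2 ≤ k * (4 * y ^ 2) := by
      have := mul_le_mul_of_nonneg_left h (by positivity : 0 ≤ 2 * k * y)
      linarith
    linarith
  · have h1 : 2 * k * y * q.2 ≤ (q.2 - y) ^ 2 := by
      have h2 : 2 * k * (y * q.2) ≤ 2 * (1 / 4) * (y * q.2) := by gcongr
      nlinarith
    nlinarith [sq_nonneg ‖x - q.1‖]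

theorem IsDistBound.le_one {ε y C : ℝ} (h : IsDistBound ε Ω u x y C) (hy : 0 < y) (hεy : ε ≤ y)
    (hxy : x ∈ Ω → u x ≤ y) : C ≤ 1 := by
  have := h (x, y) ⟨hεy, hxy⟩
  simp only [sub_self, norm_zero] at this
  refine le_of_mul_le_mul_right (a := y ^ 2) ?_ (by positivity)
  linarith

theorem IsDistBound.mul_le {ε y C : ℝ} (h : IsDistBound ε Ω u x y C) (hεy : ε ≤ u x) :
    2 * C * y * u x ≤ y ^ 2 + u x ^ 2 := by
  have := h (x, u x) ⟨hεy, fun _ => le_rfl⟩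
  simpa using this

/-- Among the points of the graph of `u₁`, there is one at the largest distance from the region above
the graph of `u₂`. -/
theorem exists_farthest_point (hΩ : IsOpen Ω) (hΩb : Bornology.IsBounded Ω)
    (h₁ : IsStrictlyLocallyConvexGraph Ω u₁) (h₂ : IsStrictlyLocallyConvexGraph Ω u₂) {ε : ℝ}
    (hε : 0 ≤ ε) (hlow : ∀ x ∈ Ω, ε < u₁ x)
    (hratio : ∀ p ∈ frontier Ω, ∀ η > 0, ∀ᶠ x in 𝓝[Ω] p, u₂ x < (1 + η) * u₁ x)
    (hx : x ∈ Ω) (hux : u₁ x < u₂ x) :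
    ∃ x₀ ∈ Ω, ∃ C > 1, IsDistBound ε Ω u₂ x₀ (u₁ x₀) C ∧
      u₁ x₀ < u₂ x₀ ∧ ∀ x ∈ Ω, ∀ C', IsDistBound ε Ω u₂ x (u₁ x) C' → C' ≤ C := by
  obtain ⟨C₁, hC₁, hbd₁⟩ := exists_isDistBound_gt_one hΩ h₂.contDiffOn.continuousOn hε
    (h₁.pos x hx) hx hux
  -- This makes η² ≤ C₁ - 1. Where `u₂ < (1 + η) u₁`, the vertical distance alone already forces
  -- cosh of the distance below `C₁`, so competitors may be restricted to `K`, which `hratio` keeps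
  -- away from the boundary.
  set η := min 1 (C₁ - 1) with hη
  have hη0 : 0 < η := lt_min one_pos (by linarith)
  have hη2 : η ^ 2 ≤ C₁ - 1 := by
    have h1 : η ≤ 1 := min_le_left _ _
    have h2 : η ≤ C₁ - 1 := min_le_right _ _
    nlinarith
  set K := {y | y ∈ Ω ∧ (1 + η) * u₁ y ≤ u₂ y} with hK
  have hKΩ : K ⊆ Ω := fun y hy => hy.1
  have hnotK : ∀ y ∈ Ω, y ∉ K → ∀ C', IsDistBound ε Ω u₂ y (u₁ y) C' → C' < C₁ := by
    intro y hy hyK C' hC'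
    have hlt : u₂ y < (1 + η) * u₁ y := by
      by_contra! h
      exact hyK ⟨hy, h⟩
    have hu1 := h₁.pos y hy
    have hu2 := h₂.pos y hy
    rcases le_or_gt (u₂ y) (u₁ y) with h | h
    · exact (hC'.le_one hu1 (hlow y hy).le fun _ => h).trans_lt hC₁
    · have h3 := hC'.mul_le ((hlow y hy).le.trans h.le)
      by_contra! hge
      have h4 : 2 * (C₁ - 1) * (u₁ y * u₁ y) ≤ 2 * (C' - 1) * (u₁ y * u₂ y) := by
        have : u₁ y * u₁ y ≤ u₁ y * u₂ y := by gcongr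
        refine mul_le_mul (by linarith) this (by positivity) (by linarith)
      have h5 : (u₂ y - u₁ y) ^ 2 < (η * u₁ y) ^ 2 :=
        pow_lt_pow_left₀ (by linarith) (by linarith) two_ne_zero
      nlinarith [mul_le_mul_of_nonneg_right hη2 (sq_nonneg (u₁ y)), sq_nonneg (u₁ y)]
  have hxK : x ∈ K := by
    by_contra h
    exact lt_irrefl _ (hnotK x hx h C₁ hbd₁)
  have hc : ∀ {u : E → ℝ}, IsStrictlyLocallyConvexGraph Ω u → ContinuousOn u K := fun h =>
    h.contDiffOn.continuousOn.mono hKΩ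
  have hKclosed : IsClosed K := by
    refine isClosed_of_closure_subset fun y hy => ?_
    have hne : (𝓝[K] y).NeBot := mem_closure_iff_nhdsWithin_neBot.1 hy
    by_cases hyΩ : y ∈ Ω
    · refine ⟨hyΩ, le_of_tendsto_of_tendsto (b := 𝓝[K] y)
        (((h₁.contDiffAt hΩ hyΩ).continuousAt.continuousWithinAt).tendsto.const_mul (1 + η))
        ((h₂.contDiffAt hΩ hyΩ).continuousAt.continuousWithinAt).tendsto ?_⟩
      filter_upwards [self_mem_nhdsWithin] with w hw using hw.2
    · exfalso
      have hyf : y ∈ frontier Ω := by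
        rw [hΩ.frontier_eq]
        exact ⟨closure_mono hKΩ hy, hyΩ⟩
      have h3 := (hratio y hyf η hη0).filter_mono (nhdsWithin_mono y hKΩ)
      obtain ⟨w, hw1, hw2⟩ := (h3.and self_mem_nhdsWithin).exists
      exact absurd hw1 (not_lt.2 hw2.2)
  have hKcpt : IsCompact K := Metric.isCompact_of_isClosed_isBounded hKclosed (hΩb.subset hKΩ)
  have hKu : ∀ y ∈ K, u₁ y < u₂ y := fun y hy => by
    have := mul_pos hη0 (h₁.pos y hy.1)
    linarith [hy.2]
  obtain ⟨B, hB⟩ := (hKcpt.image_of_continuousOn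
    (f := fun y => (u₁ y ^ 2 + u₂ y ^ 2) / (2 * u₁ y * u₂ y))
    ((((hc h₁).pow 2).add ((hc h₂).pow 2)).div (((hc h₁).const_smul (2 : ℝ)).mul (hc h₂))
      fun y hy => by
        have := h₁.pos y hy.1
        have := h₂.pos y hy.1
        exact (mul_pos (mul_pos two_pos ‹0 < u₁ y›) ‹0 < u₂ y›).ne')).bddAbove
  have hle : ∀ y ∈ K, ∀ C', IsDistBound ε Ω u₂ y (u₁ y) C' → C' ≤ B := fun y hy C' hC' => by
    have hu1 := h₁.pos y hy.1
    have hu2 := h₂.pos y hy.1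
    refine le_trans ?_ (hB ⟨y, hy, rfl⟩)
    rw [le_div_iff₀ (by positivity)]
    have := hC'.mul_le ((hlow y hy.1).le.trans (hKu y hy).le)
    linarith
  -- The maximum is taken over pairs (y, C') satisfying all distance bounds. Each bound is a closed
  -- condition, so continuity of the distance function itself is not needed.
  have hbase : IsCompact (K ×ˢ Set.Icc C₁ B) := hKcpt.prod isCompact_Icc
  have hSclosed : IsClosed ((K ×ˢ Set.Icc C₁ B) ∩ ⋂ q ∈ upperRegion ε Ω u₂,
      ((K ×ˢ Set.Icc C₁ B) ∩ (fun p : E × ℝ => ‖p.1 - q.1‖ ^ 2 + u₁ p.1 ^ 2 + q.2 ^ 2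
        - 2 * p.2 * u₁ p.1 * q.2) ⁻¹' Set.Ici 0)) := by
    refine hbase.isClosed.inter (isClosed_biInter fun q _ => ?_)
    have hcu : ContinuousOn (fun p : E × ℝ => u₁ p.1) (K ×ˢ Set.Icc C₁ B) :=
      (hc h₁).comp continuousOn_fst fun p hp => hp.1
    refine ContinuousOn.preimage_isClosed_of_isClosed ?_ hbase.isClosed isClosed_Ici
    exact ((((by fun_prop : Continuous fun p : E × ℝ => ‖p.1 - q.1‖ ^ 2).continuousOn).add
      (hcu.pow 2)).add continuousOn_const).sub
      (((by fun_prop : Continuous fun p : E × ℝ => 2 * p.2).continuousOn.mul hcu).mul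
        continuousOn_const)
  have hScpt := hbase.of_isClosed_subset hSclosed Set.inter_subset_left
  have hmem : ∀ y ∈ K, ∀ C', C₁ ≤ C' → IsDistBound ε Ω u₂ y (u₁ y) C' →
      (y, C') ∈ (K ×ˢ Set.Icc C₁ B) ∩ ⋂ q ∈ upperRegion ε Ω u₂,
      ((K ×ˢ Set.Icc C₁ B) ∩ (fun p : E × ℝ => ‖p.1 - q.1‖ ^ 2 + u₁ p.1 ^ 2 + q.2 ^ 2
        - 2 * p.2 * u₁ p.1 * q.2) ⁻¹' Set.Ici 0) := fun y hy C' h1 h2 => by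
    have h3 : (y, C') ∈ K ×ˢ Set.Icc C₁ B := ⟨hy, h1, hle y hy C' h2⟩
    refine ⟨h3, Set.mem_iInter₂.2 fun q hq => ⟨h3, ?_⟩⟩
    exact sub_nonneg.2 (h2 q hq)
  obtain ⟨⟨x₀, C⟩, ⟨⟨hx₀, hC⟩, hbound⟩, hmax⟩ := hScpt.exists_isMaxOn
    ⟨_, hmem x hxK C₁ le_rfl hbd₁⟩ (f := Prod.snd) continuousOn_snd
  have hx₀ : x₀ ∈ K := hx₀
  have hC : C₁ ≤ C := hC.1
  refine ⟨x₀, hKΩ hx₀, C, hC₁.trans_le hC, fun q hq => ?_, hKu x₀ hx₀, fun y hy C' hC' => ?_⟩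
  · exact sub_nonneg.1 (Set.mem_iInter₂.1 hbound q hq).2
  · by_cases hyK : y ∈ K
    · rcases lt_or_ge C' C₁ with h | h
      · exact h.le.trans hC
      · exact hmax (hmem y hyK C' h hC')
    · exact (hnotK y hy hyK C' hC').le.trans hC

/-- The sharp distance bound is attained at some point of the upper region. -/
theorem exists_nearest_point (hΩ : IsOpen Ω) (hu : ContinuousOn u Ω) {ε : ℝ} (hε : 0 ≤ ε)
    {y C : ℝ} (hy : 0 < y) (hyu : 0 < u x) (hεu : ε ≤ u x) (hbd : IsDistBound ε Ω u x y C)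
    (hmax : ∀ C', IsDistBound ε Ω u x y C' → C' ≤ C) :
    ∃ q ∈ upperRegion ε Ω u, 0 < q.2 ∧ ‖x - q.1‖ ^ 2 + y ^ 2 + q.2 ^ 2 = 2 * C * y * q.2 := by
  set F : E × ℝ → ℝ := fun q => ‖x - q.1‖ ^ 2 + y ^ 2 + q.2 ^ 2 with hF
  have hF0 : ∀ q, 0 < F q := fun q => by positivity
  have hFc : Continuous F := by fun_prop
  -- Minimizing the distance is maximizing q₂/F(q). Only points doing at least as well as (x, u x)
  -- matter, and they form a compact set.
  set v := u x / F (x, u x) with hv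
  have hv0 : 0 < v := div_pos hyu (hF0 _)
  have hcl : IsClosed (upperRegion ε Ω u ∩ {q | v * F q ≤ q.2}) :=
    (isClosed_upperRegion hΩ hu ε).inter (isClosed_le (by fun_prop) continuous_snd)
  have hsub : upperRegion ε Ω u ∩ {q | v * F q ≤ q.2}
      ⊆ Metric.closedBall x (1 / v) ×ˢ Set.Icc 0 (1 / v) := by
    rintro q ⟨hq, hqv⟩
    have hq0 : 0 ≤ q.2 := hε.trans hq.1
    have hqv : v * (‖x - q.1‖ ^ 2 + y ^ 2 + q.2 ^ 2) ≤ q.2 := hqv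
    have h1 : q.2 ≤ 1 / v := by
      rw [le_div_iff₀ hv0]
      rcases hq0.eq_or_lt with h | h
      · rw [← h]
        simp
      · refine le_of_mul_le_mul_right (a := q.2) ?_ h
        have : 0 ≤ v * (‖x - q.1‖ ^ 2 + y ^ 2) := by positivity
        linarith
    refine ⟨?_, hq0, h1⟩
    rw [mem_closedBall_iff_norm']
    refine le_of_sq_le_sq ?_ (by positivity)
    have h2 : v * ‖x - q.1‖ ^ 2 ≤ 1 / v := by
      have : 0 ≤ v * (y ^ 2 + q.2 ^ 2) := by positivity
      linarith
    rw [div_pow, one_pow, le_div_iff₀ (by positivity)]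
    rw [le_div_iff₀ hv0] at h2
    linarith
  have hcpt := ((isCompact_closedBall x (1 / v)).prod isCompact_Icc).of_isClosed_subset hcl hsub
  obtain ⟨q, ⟨hq, hqv⟩, hqmax⟩ := hcpt.exists_isMaxOn
    ⟨(x, u x), ⟨hεu, fun _ => le_rfl⟩, by
      change u x / F (x, u x) * F (x, u x) ≤ u x
      rw [div_mul_cancel₀ _ (hF0 _).ne']⟩
    (f := fun q => q.2 / F q)
    (continuous_snd.div hFc fun q => (hF0 q).ne').continuousOn
  have hvq : v ≤ q.2 / F q := (le_div_iff₀ (hF0 q)).2 hqv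
  set V := q.2 / F q with hV
  have hV0 : 0 < V := hv0.trans_le hvq
  have hq0 : 0 < q.2 := by
    have := hV0
    rw [hV] at this
    exact (div_pos_iff_of_pos_right (hF0 q)).1 this
  have hall : ∀ p ∈ upperRegion ε Ω u, p.2 ≤ V * F p := fun p hp => by
    by_cases hpv : v * F p ≤ p.2
    · exact (div_le_iff₀ (hF0 p)).1 (hqmax ⟨hp, hpv⟩)
    · exact (not_le.1 hpv).le.trans (mul_le_mul_of_nonneg_right hvq (hF0 p).le)
  -- This is the distance bound realized by the maximizer, so sharpness of `C` gives equality.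
  have hCV := hmax (1 / (2 * V * y)) fun p hp => by
    have h1 : 2 * (1 / (2 * V * y)) * y * p.2 = p.2 / V := by field_simp
    rw [h1, div_le_iff₀ hV0, mul_comm]
    exact hall p hp
  have hFq : F q = q.2 / V := by
    rw [hV]
    field_simp
  refine ⟨q, hq, hq0, le_antisymm ?_ (hbd q hq)⟩
  change F q ≤ _
  rw [hFq, div_le_iff₀ hV0]
  rw [div_le_iff₀ (by positivity)] at hCV
  have := mul_le_mul_of_nonneg_right hCV hq0.le
  linarith

/-- The hyperbolic ball of radius arcosh C about (x, y) is the Euclidean ball centred at (x, Cy).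
Moving q into its interior leaves the upper region; as long as the height exceeds ε, that can only
mean passing under the graph. -/
theorem nearest_point_mem_graph (hΩ : IsOpen Ω) (hu : ContinuousOn u (closure Ω)) {ε : ℝ}
    (hb : ∀ x ∈ frontier Ω, u x = ε) {y C : ℝ} (hy : 0 < y) (hεy : ε < y) (hC : 1 < C)
    (hbd : IsDistBound ε Ω u x y C) {q : E × ℝ} (hq : q ∈ upperRegion ε Ω u)
    (heq : ‖x - q.1‖ ^ 2 + y ^ 2 + q.2 ^ 2 = 2 * C * y * q.2) :
    q.1 ∈ Ω ∧ u q.1 = q.2 ∧ C * y ≤ q.2 := by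
  have hyC : y < C * y := by nlinarith
  have hge : C * y ≤ q.2 := by
    -- Otherwise raising q vertically to height Cy would enter the open ball, placing (q₁, Cy), and
    -- hence q, under the graph.
    by_contra! hlt
    have hn : (q.1, C * y) ∉ upperRegion ε Ω u := fun hmem => by
      have := hbd _ hmem
      simp only at this
      nlinarith
    have h1 : q.1 ∈ Ω ∧ C * y < u q.1 := by
      by_contra hcon
      refine hn ⟨(hεy.trans hyC).le, fun h => ?_⟩
      by_contra! hlt
      exact hcon ⟨h, hlt⟩
    have := hq.2 h1.1
    linarith [h1.2]
  have hqε : ε < q.2 := hεy.trans (hyC.trans_le hge)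
  have hlx : Filter.Tendsto (fun t : ℝ => q.1 + t • (x - q.1)) (𝓝[>] 0) (𝓝 q.1) :=
    (tendsto_line q.1 (x - q.1)).mono_left nhdsWithin_le_nhds
  have hly : Filter.Tendsto (fun t : ℝ => q.2 + t * (C * y - q.2)) (𝓝[>] 0) (𝓝 q.2) := by
    have : ContinuousAt (fun t : ℝ => q.2 + t * (C * y - q.2)) 0 := by fun_prop
    have := this.tendsto.mono_left (nhdsWithin_le_nhds (s := Set.Ioi 0))
    simpa using this
  -- Points slightly towards the Euclidean centre are inside the ball and still above height ε, so
  -- they lie under the graph; the limit gives q₂ ≤ u(q₁).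
  have hev : ∀ᶠ t : ℝ in 𝓝[>] 0, q.1 + t • (x - q.1) ∈ Ω ∧
      q.2 + t * (C * y - q.2) < u (q.1 + t • (x - q.1)) := by
    filter_upwards [hly.eventually (lt_mem_nhds hqε), Ioo_mem_nhdsGT (one_pos : (0 : ℝ) < 1)]
      with t ht ht1
    have hn : (q.1 + t • (x - q.1), q.2 + t * (C * y - q.2)) ∉ upperRegion ε Ω u := fun hmem => by
      have h1 := hbd _ hmem
      simp only at h1
      rw [show x - (q.1 + t • (x - q.1)) = (1 - t) • (x - q.1) by module, norm_smul,
        Real.norm_eq_abs, mul_pow |1 - t|, sq_abs] at h1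
      have h2 : 0 < y ^ 2 * (C ^ 2 - 1) := mul_pos (by positivity) (by nlinarith)
      have h3 : (1 - t) ^ 2 * (y ^ 2 * (C ^ 2 - 1)) < 1 * (y ^ 2 * (C ^ 2 - 1)) :=
        mul_lt_mul_of_pos_right (by nlinarith [ht1.1, ht1.2]) h2
      nlinarith
    by_contra hcon
    refine hn ⟨ht.le, fun h => ?_⟩
    by_contra! hlt
    exact hcon ⟨h, hlt⟩
  have hcl : q.1 ∈ closure Ω := mem_closure_of_tendsto hlx (hev.mono fun t ht => ht.1)
  have hlu : Filter.Tendsto (fun t : ℝ => u (q.1 + t • (x - q.1))) (𝓝[>] 0) (𝓝 (u q.1)) :=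
    (hu _ hcl).tendsto.comp
      (tendsto_nhdsWithin_iff.2 ⟨hlx, hev.mono fun t ht => subset_closure ht.1⟩)
  have hle : q.2 ≤ u q.1 := le_of_tendsto_of_tendsto hly hlu (hev.mono fun t ht => ht.2.le)
  have hqΩ : q.1 ∈ Ω := by
    by_contra hn
    have : q.1 ∈ frontier Ω := by
      rw [hΩ.frontier_eq]
      exact ⟨hcl, hn⟩
    rw [hb _ this] at hle
    linarith
  exact ⟨hqΩ, le_antisymm (hq.2 hqΩ) hle, hge⟩

/-- The nearest point of the graph sees the given point along its normal. -/
theorem depthExcess_eq_zero_of_nearest {S C ε : ℝ} (hS : 0 ≤ S) (hCS : C ^ 2 = 1 + S ^ 2)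
    (hu₁ : 0 < u₁ x) (hC₂ : ContDiffAt ℝ 2 u₂ z) (hzε : ε < u₂ z)
    (hbd : IsDistBound ε Ω u₂ x (u₁ x) C)
    (heq : ‖x - z‖ ^ 2 + u₁ x ^ 2 + u₂ z ^ 2 = 2 * C * u₁ x * u₂ z)
    (hge : C * u₁ x ≤ u₂ z) : depthExcess S u₁ u₂ x z = 0 := by
  have hw := slopeFactor_pos u₂ z
  have hw2 := slopeFactor_sq u₂ z
  have hmin : ∀ᶠ y in 𝓝 z, 2 * C * u₁ x * u₂ y ≤ ‖x - y‖ ^ 2 + u₁ x ^ 2 + u₂ y ^ 2 := by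
    filter_upwards [hC₂.continuousAt.eventually (lt_mem_nhds hzε)] with y hy
    exact hbd (y, u₂ y) ⟨hy.le, fun _ => le_rfl⟩
  have hgrad : x - z = (u₂ z - C * u₁ x) • ∇ u₂ z := by
    refine ext_inner_right ℝ fun a => ?_
    rw [inner_smul_left, inner_gradient, RCLike.conj_to_real]
    have hm : IsLocalMin (fun t : ℝ => ‖x - (z + t • a)‖ ^ 2 + u₁ x ^ 2 + u₂ (z + t • a) ^ 2
        - 2 * C * u₁ x * u₂ (z + t • a)) 0 := by
      filter_upwards [(tendsto_line z a).eventually hmin] with t ht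
      simp only [zero_smul, add_zero]
      linarith
    have e2 := (hasDerivAt_comp_line hC₂ a).self_of_nhds
    have e3 := (hasDerivAt_line z a 0).const_sub x
    have hd := ((e3.norm_sq.add_const (u₁ x ^ 2)).add (e2.pow 2)).sub (e2.const_mul (2 * C * u₁ x))
    have := hm.hasDerivAt_eq_zero hd
    simp at this
    linarith
  have hn : ‖x - z‖ ^ 2 = (u₂ z - C * u₁ x) ^ 2 * (slopeFactor u₂ z ^ 2 - 1) := by
    rw [hgrad, norm_smul, mul_pow, Real.norm_eq_abs, sq_abs, hw2]
    ring
  have hi : ⟪∇ u₂ z, x - z⟫_ℝ = (u₂ z - C * u₁ x) * (slopeFactor u₂ z ^ 2 - 1) := by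
    rw [hgrad, inner_smul_right, real_inner_self_eq_norm_sq, hw2]
    ring
  have hsq : ((u₂ z - C * u₁ x) * slopeFactor u₂ z) ^ 2 = (u₁ x * S) ^ 2 := by
    rw [hn] at heq
    linear_combination heq + u₁ x ^ 2 * hCS
  -- `hge` selects the root for which the given point is below the tangent hyperplane.
  rw [sq_eq_sq₀ (mul_nonneg (sub_nonneg.2 hge) hw.le) (by positivity)] at hsq
  rw [depthExcess, hn, hi]
  have hsq2 : ((u₂ z - C * u₁ x) * slopeFactor u₂ z) ^ 2 = (u₁ x * S) ^ 2 := by rw [hsq]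
  linear_combination (2 * u₂ z * slopeFactor u₂ z) * hsq - hsq2 + u₁ x ^ 2 * hCS

/-- If `u₁` is somewhere at most `u₂`, some pair of points of the two graphs lies on a common
normal geodesic and is extremal for the depth. -/
theorem exists_extremal_pair (hΩ : IsOpen Ω) (hΩb : Bornology.IsBounded Ω)
    (h₁ : IsStrictlyLocallyConvexGraph Ω u₁) (h₂ : IsStrictlyLocallyConvexGraph Ω u₂) {ε : ℝ}
    (hε : 0 ≤ ε) (hlow : ∀ x ∈ Ω, ε < u₁ x) (hb : ∀ x ∈ frontier Ω, u₂ x = ε)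
    (hratio : ∀ p ∈ frontier Ω, ∀ η > 0, ∀ᶠ x in 𝓝[Ω] p, u₂ x < (1 + η) * u₁ x)
    (hx : x ∈ Ω) (hux : u₁ x ≤ u₂ x) :
    ∃ S C : ℝ, 0 ≤ S ∧ 0 < C ∧ C ^ 2 = 1 + S ^ 2 ∧ ∃ x₀ ∈ Ω, ∃ z₀ ∈ Ω, ε < u₂ z₀ ∧
      depthExcess S u₁ u₂ x₀ z₀ = 0 ∧
      ∀ x ∈ Ω, ∀ C', IsDistBound ε Ω u₂ x (u₁ x) C' → C' ≤ C := by
  by_cases hall : ∀ y ∈ Ω, u₂ y ≤ u₁ y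
  -- The graphs touch at x without crossing: the distance is zero and the pair is (x, x).
  · refine ⟨0, 1, le_rfl, one_pos, by norm_num, x, hx, x, hx, (hlow x hx).trans_le hux, ?_,
      fun y hy C' hC' => hC'.le_one (h₁.pos y hy) (hlow y hy).le fun _ => hall y hy⟩
    simp [depthExcess, le_antisymm hux (hall x hx)]
  · push Not at hall
    obtain ⟨y, hy, huy⟩ := hall
    obtain ⟨x₀, hx₀, C, hC, hbd, hlt, hmax⟩ :=
      exists_farthest_point hΩ hΩb h₁ h₂ hε hlow hratio hy huy
    obtain ⟨q, hq, -, heq⟩ := exists_nearest_point hΩ h₂.contDiffOn.continuousOn hε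
      (h₁.pos x₀ hx₀) (h₂.pos x₀ hx₀) ((hlow x₀ hx₀).trans hlt).le hbd (hmax x₀ hx₀)
    obtain ⟨hqΩ, huq, hge⟩ := nearest_point_mem_graph hΩ h₂.continuousOn hb (h₁.pos x₀ hx₀)
      (hlow x₀ hx₀) hC hbd hq heq
    have hqε : ε < u₂ q.1 := by
      have := hlow x₀ hx₀
      have := h₁.pos x₀ hx₀
      rw [huq]
      nlinarith
    have hC2 : 0 ≤ C ^ 2 - 1 := by nlinarith
    have hCS : C ^ 2 = 1 + Real.sqrt (C ^ 2 - 1) ^ 2 := by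
      rw [Real.sq_sqrt hC2]
      ring
    rw [← huq] at heq hge
    exact ⟨Real.sqrt (C ^ 2 - 1), C, Real.sqrt_nonneg _, by linarith, hCS, x₀, hx₀, q.1, hqΩ, hqε,
      depthExcess_eq_zero_of_nearest (Real.sqrt_nonneg _) hCS (h₁.pos x₀ hx₀)
        (h₂.contDiffAt hΩ hqΩ) hqε hbd heq hge, hmax⟩

/-! ### The comparison theorem -/

/-- The comparison principle, given control of the two graphs at the boundary. -/
theorem lt_of_curvature_lt (hf : IsCurvatureFunction f)
    (hf' : ∀ l ∈ posCone n, 0 < f l → f l < 1 →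
      ∑ i, l i ^ 2 * partialDeriv f i l < ∑ i, partialDeriv f i l)
    (hΩ : IsOpen Ω) (hΩb : Bornology.IsBounded Ω)
    (h₁ : IsStrictlyLocallyConvexGraph Ω u₁) (h₂ : IsStrictlyLocallyConvexGraph Ω u₂) {ε : ℝ}
    (hε : 0 ≤ ε) (hlow : ∀ x ∈ Ω, ε < u₁ x) (hb : ∀ x ∈ frontier Ω, u₂ x = ε)
    (hratio : ∀ p ∈ frontier Ω, ∀ η > 0, ∀ᶠ x in 𝓝[Ω] p, u₂ x < (1 + η) * u₁ x)
    (hone : ∀ x ∈ Ω, f (principalCurvatures u₁ x) < 1)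
    (hlt : ∀ x ∈ Ω, ∀ z ∈ Ω, f (principalCurvatures u₁ x) < f (principalCurvatures u₂ z)) :
    ∀ x ∈ Ω, u₂ x < u₁ x := by
  intro x hx
  by_contra! hux
  obtain ⟨S, C, hS, hC, hCS, x₀, hx₀, z₀, hz₀, hzε, h0, hmax⟩ :=
    exists_extremal_pair hΩ hΩb h₁ h₂ hε hlow hb hratio hx hux
  have hev := eventually_depthExcess_nonpos hΩ h₁ h₂ hε hb hS hCS hmax hx₀ hz₀ hzε
  obtain ⟨W, hW, hκ⟩ := exists_doublyStochastic_of_isLocalMax hS hC hCS (h₁.contDiffAt hΩ hx₀)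
    (h₂.contDiffAt hΩ hz₀) (h₁.pos _ hx₀) (h₂.pos _ hz₀) (h₁.isPrincipalCurvatures hΩ hx₀)
    (h₂.isPrincipalCurvatures hΩ hz₀) (h₂.convex _ hz₀) h0
    (hev.mono fun p hp => hp.trans_eq h0.symm)
  set κ₂ := principalCurvatures u₂ z₀ with hκ₂
  have hκ₂pos : κ₂ ∈ posCone n := h₂.convex z₀ hz₀
  have hSC : S < C := by
    by_contra! h
    nlinarith
  -- S/C is tanh of the distance, the parameter of the parallel flow.
  have hpar := hf.min_le_parallel hf' hκ₂pos (div_nonneg hS hC.le) ((div_lt_one hC).2 hSC)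
  have hfun : (fun i => (S / C + κ₂ i) / (1 + S / C * κ₂ i))
      = fun j => (S + C * κ₂ j) / (C + S * κ₂ j) := by
    ext i
    have : 0 < C + S * κ₂ i := add_pos_of_pos_of_nonneg hC (mul_nonneg hS (hκ₂pos i).le)
    have h2 : 1 + S / C * κ₂ i = (C + S * κ₂ i) / C := by field_simp
    rw [h2]
    field_simp
  rw [hfun] at hpar
  set k : Fin n → ℝ := fun j => (S + C * κ₂ j) / (C + S * κ₂ j) with hk
  have hkpos : k ∈ posCone n := fun i =>
    div_pos (add_pos_of_nonneg_of_pos hS (mul_pos hC (hκ₂pos i)))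
      (add_pos_of_pos_of_nonneg hC (mul_nonneg hS (hκ₂pos i).le))
  have hWk : W.mulVec k ∈ posCone n := fun i => by
    obtain ⟨hW0, hW1, -⟩ := mem_doublyStochastic_iff_sum.1 hW
    obtain ⟨j, -, hj⟩ := Finset.exists_ne_zero_of_sum_ne_zero
      (s := Finset.univ) (f := fun j => W i j) (by rw [hW1]; exact one_ne_zero)
    exact Finset.sum_pos' (fun j _ => mul_nonneg (hW0 i j) (hkpos j).le)
      ⟨j, Finset.mem_univ _, mul_pos (lt_of_le_of_ne (hW0 i j) hj.symm) (hkpos j)⟩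
  -- min(f(κ₂), 1) ≤ f(k) ≤ f(W k) ≤ f(κ₁): parallel flow, averaging, monotonicity.
  have h3 := hpar.trans ((hf.le_mulVec_of_doublyStochastic hkpos hW).trans (hf.mono hWk hκ))
  exact absurd h3 (not_le.2 (lt_min (hlt x₀ hx₀ z₀ hz₀) (hone x₀ hx₀)))

/-- A graph with constant boundary values whose curvature is less than one lies above the horosphere
through its boundary. -/
theorem lt_of_boundary_eq_of_curvature_lt_one (hf : IsCurvatureFunction f) (hΩ : IsOpen Ω)
    (hΩb : Bornology.IsBounded Ω) (h : IsStrictlyLocallyConvexGraph Ω u) {ε : ℝ}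
    (hb : ∀ x ∈ frontier Ω, u x = ε) (hone : ∀ x ∈ Ω, f (principalCurvatures u x) < 1) :
    ∀ x ∈ Ω, ε < u x := by
  intro x hx
  by_contra! hle
  have hcpt : IsCompact (closure Ω) :=
    Metric.isCompact_of_isClosed_isBounded isClosed_closure hΩb.closure
  obtain ⟨y, hy, hmin⟩ := hcpt.exists_isMinOn ⟨x, subset_closure hx⟩ h.continuousOn
  have key : ∃ y ∈ Ω, IsMinOn u (closure Ω) y := by
    by_cases hyΩ : y ∈ Ω
    · exact ⟨y, hyΩ, hmin⟩
    · have hyf : y ∈ frontier Ω := by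
        rw [hΩ.frontier_eq]
        exact ⟨hy, hyΩ⟩
      -- If the minimum is attained on the boundary its value is ε, so the interior point x with
      -- u(x) ≤ ε is a minimum too.
      have hle' : u x ≤ u y := by rwa [hb y hyf]
      exact ⟨x, hx, fun w hw => hle'.trans (hmin hw)⟩
  obtain ⟨y, hyΩ, hmin⟩ := key
  have hloc : IsLocalMin u y :=
    hmin.isLocalMin (Filter.mem_of_superset (hΩ.mem_nhds hyΩ) subset_closure)
  have := hf.le_of_forall_le one_pos fun i =>
    one_le_curvature_of_isLocalMin (h.isPrincipalCurvatures hΩ hyΩ) (h.pos y hyΩ)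
      (h.contDiffAt hΩ hyΩ) hloc i
  exact absurd (hone y hyΩ) (not_lt.2 this)

/-- A graph with zero boundary values has a point where the curvature is at most one. -/
theorem exists_curvature_le_one (hf : IsCurvatureFunction f) (hΩ : IsOpen Ω)
    (hΩb : Bornology.IsBounded Ω) (hne : Ω.Nonempty) (h : IsStrictlyLocallyConvexGraph Ω u)
    (hb : ∀ x ∈ frontier Ω, u x = 0) : ∃ x ∈ Ω, f (principalCurvatures u x) ≤ 1 := by
  have hcpt : IsCompact (closure Ω) :=
    Metric.isCompact_of_isClosed_isBounded isClosed_closure hΩb.closure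
  obtain ⟨x, hx⟩ := hne
  obtain ⟨y, hy, hmax⟩ := hcpt.exists_isMaxOn ⟨x, subset_closure hx⟩ h.continuousOn
  have hpos : 0 < u y := (h.pos x hx).trans_le (hmax (subset_closure hx))
  have hyΩ : y ∈ Ω := by
    by_contra hn
    have hyf : y ∈ frontier Ω := by
      rw [hΩ.frontier_eq]
      exact ⟨hy, hn⟩
    exact hpos.ne' (hb y hyf)
  have hloc : IsLocalMax u y :=
    hmax.isLocalMax (Filter.mem_of_superset (hΩ.mem_nhds hyΩ) subset_closure)
  exact ⟨y, hyΩ, hf.apply_le_of_forall_le (h.convex y hyΩ) one_pos fun i =>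
    curvature_le_one_of_isLocalMax (h.isPrincipalCurvatures hΩ hyΩ) hpos (h.contDiffAt hΩ hyΩ)
      hloc i⟩

end HyperbolicGraph

theorem mainTheorem8 {n : ℕ} (f : (Fin n → ℝ) → ℝ) (hf : IsCurvatureFunction f)
    (hf' : ∀ l ∈ posCone n, 0 < f l → f l < 1 →
      ∑ i, l i ^ 2 * partialDeriv f i l < ∑ i, partialDeriv f i l)
    (Ω : Set (EuclideanSpace ℝ (Fin n))) (hΩ : IsBoundedSmoothDomain Ω)
    (u₁ u₂ : EuclideanSpace ℝ (Fin n) → ℝ)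
    (h₁ : IsStrictlyLocallyConvexGraph Ω u₁) (h₂ : IsStrictlyLocallyConvexGraph Ω u₂)
    (hboundary :
      (∀ x ∈ frontier Ω, u₁ x = 0 ∧ u₂ x = 0) ∨
      (∃ ε : ℝ, 0 < ε ∧ (∀ x ∈ frontier Ω, u₁ x = ε ∧ u₂ x = ε) ∧
        ∀ x ∈ Ω, f (principalCurvatures u₁ x) < 1))
    (hbdd : BddAbove ((fun x => f (principalCurvatures u₁ x)) '' Ω))
    (hcurv : ∀ y ∈ Ω,
      sSup ((fun x => f (principalCurvatures u₁ x)) '' Ω) < f (principalCurvatures u₂ y)) :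
    ∀ x ∈ Ω, u₂ x < u₁ x := by
  set s := sSup ((fun x => f (principalCurvatures u₁ x)) '' Ω) with hs
  have hle : ∀ x ∈ Ω, f (principalCurvatures u₁ x) ≤ s := fun x hx =>
    le_csSup hbdd ⟨x, hx, rfl⟩
  have hlt : ∀ x ∈ Ω, ∀ z ∈ Ω, f (principalCurvatures u₁ x) < f (principalCurvatures u₂ z) :=
    fun x hx z hz => (hle x hx).trans_lt (hcurv z hz)
  rcases hboundary with hb | ⟨ε, hε, hb, hone⟩
  · obtain ⟨y, hy, hy1⟩ := exists_curvature_le_one hf hΩ.isOpen hΩ.isBounded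
      hΩ.isConnected.nonempty h₂ fun x hx => (hb x hx).2
    -- The curvature of the second graph exceeds s everywhere and is at most 1 at the top of that
    -- graph. Hence m = s/√(1 - s²) is defined, the value for which m/√(1 + m²) = s.
    have hs1 : s < 1 := (hcurv y hy).trans_le hy1
    have hs0 : 0 < s := (hf.pos _ (h₁.convex y hy)).trans_le (hle y hy)
    have h1s : 0 < 1 - s ^ 2 := by nlinarith
    have hsm : s ^ 2 * (1 + (s / Real.sqrt (1 - s ^ 2)) ^ 2)
        = (s / Real.sqrt (1 - s ^ 2)) ^ 2 := by
      rw [div_pow, Real.sq_sqrt h1s.le]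
      field_simp
      ring
    exact lt_of_curvature_lt hf hf' hΩ.isOpen hΩ.isBounded h₁ h₂ le_rfl h₁.pos
      (fun x hx => (hb x hx).2)
      (fun p hp η hη => eventually_lt_mul_of_zero_boundary hf hΩ h₁ h₂
        (fun x hx => (hb x hx).1) (fun x hx => (hb x hx).2) hs0 (by positivity) hsm hle hcurv hp hη)
      (fun x hx => (hle x hx).trans_lt hs1) hlt
  · refine lt_of_curvature_lt hf hf' hΩ.isOpen hΩ.isBounded h₁ h₂ hε.le
      (lt_of_boundary_eq_of_curvature_lt_one hf hΩ.isOpen hΩ.isBounded h₁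
        (fun x hx => (hb x hx).1) hone) (fun x hx => (hb x hx).2) (fun p hp η hη => ?_) hone hlt
    -- Both graphs tend to the positive height ε, and ε < (1 + η) ε.
    have hpc : p ∈ closure Ω := frontier_subset_closure hp
    have hc1 := ((h₁.continuousOn p hpc).mono subset_closure).tendsto.const_mul (1 + η)
    have hc2 := ((h₂.continuousOn p hpc).mono subset_closure).tendsto
    refine hc2.eventually_lt hc1 ?_
    rw [(hb p hp).1, (hb p hp).2]
    nlinarith
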